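/- Let ${\bm a}(\lambda)=\sum_{k=-d_2}^{d_1}a_k\lambda^k$ be a Laurent polynomial with complex coefficients, $d_1,d_2\ge 0$ integers, and put $a_k=0$ for $k\notin[-d_2,d_1]$. For $N\ge 1$ let $T_N=(a_{j-i})_{i,j=1}^N$ be the $N\times N$ Toeplitz matrix with symbol ${\bm a}$, and let $\mu_{\bm a}$ be the law of ${\bm a}(U)$, where $U$ is uniformly distributed on the unit circle of $\mathbb{C}$. For an $N\times N$ complex matrix $A$ with eigenvalues $\lambda_1,\dots,\lambda_N$, listed with algebraic multiplicity, write $L_N^A=\frac1N\sum_{i=1}^N\delta_{\lambda_i}$, and for a probability measure $\mu$ on $\mathbb{C}$ write $\mathcal{L}_\mu(z)=\int\log|z-x|\,d\mu(x)$. Then there exist random $N\times N$ matrices $\Delta_N$, $N\ge1$, on a common probability space, such that the following hold. 1. For some $\gamma_\star>d_1+d_2$, $$(\Delta_N)_{i,j}=\begin{cases}N^{-\gamma_\star}\,\delta^{(N)}_{i,j} & \text{if } i-j\in\{N-\ell:1\le\ell\le d_1\}\ \text{ or }\ j-i\in\{N-\ell:1\le\ell\le d_2\},\\ 0&\text{otherwise,}\end{cases}$$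 where for each $N$ the $\delta^{(N)}_{i,j}$, $1\le i,j\le N$, are independent real random variables having densities with respect to Lebesgue measure, and both the variables and their densities are bounded uniformly in $i,j,N$. 2. For some $\gamma_0>0$, $\mathbb{P}(\|\Delta_N\|\ge N^{-\gamma_0})\to0$ as $N\to\infty$, where $\|\cdot\|$ is the operator norm on Euclidean $\mathbb{C}^N$. 3. $L_N^{T_N+\Delta_N}$ converges weakly, in probability, to $\mu_{\bm a}$; that is, $\int f\,dL_N^{T_N+\Delta_N}\to\int f\,d\mu_{\bm a}$ in probability for every bounded continuous $f:\mathbb{C}\to\mathbb{R}$. 4. For Lebesgue almost every $z\in\mathbb{C}$: the integral defining $\mathcal{L}_{\mu_{\bm a}}(z)$ converges absolutely; for every $N$, almost surely $z$ is not an eigenvalue of $T_N+\Delta_N$, so that $\mathcal{L}_{L_N^{T_N+\Delta_N}}(z)$ is finite; and $\mathcal{L}_{L_N^{T_N+\Delta_N}}(z)\to\mathcal{L}_{\mu_{\bm a}}(z)$ in probability. -/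

import Mathlib

open MeasureTheory ProbabilityTheory Filter Topology
open scoped ENNReal BoundedContinuousFunction LaurentPolynomial

noncomputable section

namespace ToeplitzPerturbation

/-- The function `𝒂(w) = ∑ₖ aₖ wᵏ` of a Laurent polynomial with complex coefficients. -/
def symbol (a : ℂ[T;T⁻¹]) (w : ℂ) : ℂ :=
  a.coeff.sum fun k c => c * w ^ k

/-- The `N × N` Toeplitz matrix with symbol `a`: its `(i, j)` entry is `a_{j - i}`. -/
def toeplitz (a : ℂ[T;T⁻¹]) (N : ℕ) : Matrix (Fin N) (Fin N) ℂ :=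
  Matrix.of fun i j => a.coeff ((j : ℤ) - (i : ℤ))

/-- The empirical spectral distribution `N⁻¹ ∑ᵢ δ_{λᵢ}` of an `N × N` matrix; the eigenvalues are
listed with algebraic multiplicity, as the roots of the characteristic polynomial. -/
def esd {N : ℕ} (A : Matrix (Fin N) (Fin N) ℂ) : Measure ℂ :=
  (N : ℝ≥0∞)⁻¹ • (A.charpoly.roots.map Measure.dirac).sum

/-- The uniform distribution on the unit circle of `ℂ`, as the law of `exp (iθ)` with `θ` uniform
on `(0, 2π]`. -/
def uniformCircle : Measure ℂ :=
  Measure.map (circleMap 0 1)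
    ((ENNReal.ofReal (2 * Real.pi))⁻¹ • volume.restrict (Set.Ioc 0 (2 * Real.pi)))

/-- `μ_𝒂`, the law of `𝒂(U)` with `U` uniform on the unit circle. -/
def symbolLaw (a : ℂ[T;T⁻¹]) : Measure ℂ :=
  Measure.map (symbol a) uniformCircle

/-- The logarithmic potential `∫ log |z - x| dμ(x)`. -/
def logPotential (μ : Measure ℂ) (z : ℂ) : ℝ :=
  ∫ x, Real.log ‖z - x‖ ∂μ

/-- The spectral norm: the operator norm on `ℂᴺ` with the Euclidean norm. -/
def operatorNorm {N : ℕ} (A : Matrix (Fin N) (Fin N) ℂ) : ℝ :=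
  ‖Matrix.toEuclideanCLM (n := Fin N) (𝕜 := ℂ) A‖

/-- The random measures `L N` converge weakly, in probability, to the deterministic measure `μ`:
`∫ f dL N → ∫ f dμ` in probability, for every bounded continuous `f`. -/
def TendstoWeaklyInProbability {Ω : Type*} [MeasurableSpace Ω] (P : Measure Ω)
    (L : ℕ → Ω → Measure ℂ) (μ : Measure ℂ) : Prop :=
  ∀ f : ℂ →ᵇ ℝ, TendstoInMeasure P (fun N ω => ∫ x, f x ∂(L N ω)) atTop (fun _ => ∫ x, f x ∂μ)

/-- The `(i, j)` entry lies in the lower left corner of width `d₁`, that is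
`i - j ∈ {N - ℓ : 1 ≤ ℓ ≤ d₁}`, or in the upper right corner of width `d₂`, that is
`j - i ∈ {N - ℓ : 1 ≤ ℓ ≤ d₂}`. -/
def InCorner (d₁ d₂ N : ℕ) (i j : Fin N) : Prop :=
  (∃ l : ℕ, 1 ≤ l ∧ l ≤ d₁ ∧ (i : ℤ) - (j : ℤ) = (N : ℤ) - (l : ℤ)) ∨
    (∃ l : ℕ, 1 ≤ l ∧ l ≤ d₂ ∧ (j : ℤ) - (i : ℤ) = (N : ℤ) - (l : ℤ))

open Classical in
/-- The `N × N` matrix with entries `N ^ (-γ) * δᵢⱼ` in the two corners and zeros elsewhere. -/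
def cornerMatrix (d₁ d₂ : ℕ) (γ : ℝ) {N : ℕ} (δ : Fin N → Fin N → ℝ) :
    Matrix (Fin N) (Fin N) ℂ :=
  Matrix.of fun i j => if InCorner d₁ d₂ N i j then (((N : ℝ) ^ (-γ) * δ i j : ℝ) : ℂ) else 0

/-- For each `N`, an `N × N` array of independent real random variables; the variables, and their
densities with respect to Lebesgue measure, are bounded uniformly in the position and in `N`. -/
structure IsBoundedDensityArray {Ω : Type*} [MeasurableSpace Ω] (P : Measure Ω)
    (δ : ∀ N : ℕ, Fin N → Fin N → Ω → ℝ) : Prop where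
  measurable : ∀ N i j, Measurable (δ N i j)
  indep : ∀ N : ℕ, iIndepFun (fun p : Fin N × Fin N => δ N p.1 p.2) P
  bounded : ∃ K : ℝ, ∀ N i j, ∀ᵐ ω ∂P, |δ N i j ω| ≤ K
  hasPDF : ∀ N i j, HasPDF (δ N i j) P volume
  pdf_bounded : ∃ M : NNReal, ∀ N i j, ∀ᵐ x : ℝ, pdf (δ N i j) P volume x ≤ (M : ℝ≥0∞)

end ToeplitzPerturbation

end

/-!
The noise is uniform on the unit interval, independent over all positions, and scaled by
`N ^ (-(d₁ + d₂ + 2))`.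

The `N × N` circulant matrix `C_N` with symbol `𝒂` has the eigenvalues `𝒂(ω)`, `ω ^ N = 1`, and
differs from `T_N` only in the two corners that carry the noise. Fix `z` off the curve `𝒂(S¹)`, which
is a null set by Sard's lemma. Then `N⁻¹ log |det (z - C_N)|` is a Riemann sum of
`log |z - 𝒂(exp (iθ))|` and converges to the log-potential of `μ_𝒂`. It remains to compare
`det (z - T_N - Δ_N)` with `det (z - C_N)`.

* From above: `T_N + Δ_N - C_N` has at most `d₁ + d₂` non-zero columns and bounded entries, and
  `(z - C_N)⁻¹` is a circulant matrix with bounded entries, so the quotient of the determinants is the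
  determinant of a matrix of bounded size with entries of order `N` (`norm_det_add_le`).
* From below: the determinant is affine in each of the noise variables, whose number is bounded, and
  `det (z - C_N)` is its value at a point of polynomial size. The mean of the logarithm of an affine
  function over the unit interval is at least the logarithm of its value at any complex point `y`, up
  to `O(log (|y| + 2))`. Replacing the variables one at a time gives a lower bound for the mean of
  `log |det (z - T_N - Δ_N)|` (`IsMultiAffine.ae_ne_zero_and_lintegral_le`).

An upper bound that holds surely and a lower bound for the mean give convergence in mean, with error
`O(log N / N)` in addition to that of the Riemann sum (`lintegral_log_det_sub_le`,
`tendsto_lintegral_logDet_sub`).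

Weak convergence follows from that of the log-potentials. The difference of the logarithmic
potentials of two concentric annuli is, by the mean value property, a non-negative bump function
(`logBump`) of compact support. So the integral of a mollified test function against a measure is an
integral of the log-potential of that measure, and the integrals of `f` against two measures on a disc
differ little if their log-potentials are close in `L¹` (`exists_enorm_integral_sub_le`). Convergence
in `L¹` follows from convergence at almost every `z` and a uniform `L²` bound
(`tendsto_lintegral_of_sq_bounded`).
-/

namespace ToeplitzPerturbation

/-! ### Anti-concentration for multi-affine functions -/

/-- On the unit interval, an affine function is bounded below by its value at a complex point `y`,
times the distance to a real point `τ` that stands for its zero, up to the factor `Y + 2`. -/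
theorem exists_mul_abs_sub_le_norm_affine (p q y : ℂ) {Y : ℝ} (hy : ‖y‖ ≤ Y) :
    ∃ τ ∈ Set.Icc (0 : ℝ) 1, ∀ t ∈ Set.Icc (0 : ℝ) 1,
      ‖p + y * q‖ * |t - τ| ≤ (Y + 2) * ‖p + t * q‖ := by
  have hY : 0 ≤ Y := (norm_nonneg y).trans hy
  by_cases hq : q = 0
  · refine ⟨0, by simp, fun t ht => ?_⟩
    have h1 : |t - 0| ≤ 1 := by rw [sub_zero, abs_of_nonneg ht.1]; exact ht.2
    subst hq
    simp only [mul_zero, add_zero]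
    nlinarith [norm_nonneg p, abs_nonneg (t - 0)]
  · obtain ⟨w, rfl⟩ : ∃ w, p = w * q := ⟨p / q, by field_simp⟩
    -- `τ` is the point of the unit interval closest to the zero `-w` of the affine function
    refine ⟨max 0 (min 1 (-w.re)), by simp, fun t ht => ?_⟩
    set τ := max 0 (min 1 (-w.re)) with hτ
    have hτ0 : 0 ≤ τ := le_max_left _ _
    have hτ1 : τ ≤ 1 := by simp [hτ]
    have h1 : |t - τ| ≤ ‖w + t‖ := by
      refine le_trans ?_ (Complex.abs_re_le_norm _)
      simp only [Complex.add_re, Complex.ofReal_re]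
      obtain ⟨h0, h1⟩ := ht
      rcases le_total 1 (-w.re) with h | h
      · have : τ = 1 := by simp [hτ, h]
        rw [this, abs_of_nonpos (by linarith), abs_of_nonpos (by linarith)]; linarith
      · rcases le_total 0 (-w.re) with h' | h'
        · have : τ = -w.re := by simp [hτ, h, h']
          rw [this]; apply le_of_eq; congr 1; ring
        · have : τ = 0 := by simp [hτ, h, h']
          rw [this, abs_of_nonneg (by linarith), abs_of_nonneg (by linarith)]; linarith
    have h2 : |t - τ| ≤ 1 := by
      rw [abs_le]; constructor <;> linarith [ht.1, ht.2]
    have h3 : ‖w + y‖ ≤ ‖w + t‖ + (Y + 1) := by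
      have : w + y = (w + t) + (y - t) := by ring
      rw [this]
      refine (norm_add_le _ _).trans ?_
      have h4 : ‖y - t‖ ≤ ‖y‖ + ‖(t : ℂ)‖ := norm_sub_le _ _
      have h5 : ‖(t : ℂ)‖ ≤ 1 := by
        rw [Complex.norm_real, Real.norm_of_nonneg ht.1]; exact ht.2
      linarith
    rw [← add_mul, ← add_mul, norm_mul, norm_mul]
    have h6 : ‖w + y‖ * |t - τ| ≤ (Y + 2) * ‖w + t‖ := by
      calc ‖w + y‖ * |t - τ| ≤ (‖w + t‖ + (Y + 1)) * |t - τ| := by gcongr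
        _ = ‖w + t‖ * |t - τ| + (Y + 1) * |t - τ| := by ring
        _ ≤ ‖w + t‖ * 1 + (Y + 1) * ‖w + t‖ := by gcongr
        _ = _ := by ring
    calc ‖w + y‖ * ‖q‖ * |t - τ| = ‖w + y‖ * |t - τ| * ‖q‖ := by ring
      _ ≤ (Y + 2) * ‖w + t‖ * ‖q‖ := by gcongr
      _ = _ := by ring

theorem lintegral_neg_log_abs_sub_le {τ : ℝ} (hτ : τ ∈ Set.Icc (0 : ℝ) 1) :
    ∫⁻ t : unitInterval, ENNReal.ofReal (-Real.log |(t : ℝ) - τ|) ≤ 2 := by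
  have hint : IntervalIntegrable (fun t : ℝ => Real.log (t - τ)) volume 0 1 := by
    have := (intervalIntegral.intervalIntegrable_log' (a := 0 - τ) (b := 1 - τ)).comp_sub_right τ
    simpa using this
  have hval : -∫ t in (0 : ℝ)..1, Real.log (t - τ) ≤ 2 := by
    rw [intervalIntegral.integral_comp_sub_right (fun x => Real.log x), integral_log]
    have key : ∀ x : ℝ, 0 ≤ x → -(x * Real.log x) ≤ 1 - x := fun x hx => by
      rcases hx.eq_or_lt with rfl | hx
      · simp
      · have := Real.one_sub_inv_le_log_of_pos hx
        have h2 : x * (1 - x⁻¹) ≤ x * Real.log x := by gcongr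
        have h3 : x * (1 - x⁻¹) = x - 1 := by field_simp
        linarith
    have h1 := key τ hτ.1
    have h2 := key (1 - τ) (by linarith [hτ.2])
    have h3 : Real.log (0 - τ) = Real.log τ := by rw [zero_sub, Real.log_neg_eq_log]
    rw [h3]
    linarith
  calc ∫⁻ t : unitInterval, ENNReal.ofReal (-Real.log |(t : ℝ) - τ|)
      = ∫⁻ t in Set.Icc (0 : ℝ) 1, ENNReal.ofReal (-Real.log (t - τ)) := by
        simp_rw [Real.log_abs]
        rw [← unitInterval.measurePreserving_coe.lintegral_comp_emb
          unitInterval.measurableEmbedding_coe]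
    _ = ENNReal.ofReal (∫ t in Set.Icc (0 : ℝ) 1, -Real.log (t - τ)) := by
        rw [ofReal_integral_eq_lintegral_ofReal]
        · rw [intervalIntegrable_iff_integrableOn_Icc_of_le zero_le_one] at hint
          exact hint.neg
        · refine (ae_restrict_iff' measurableSet_Icc).2 (Eventually.of_forall fun t ht => ?_)
          simp only [Pi.zero_apply, Left.nonneg_neg_iff]
          rw [← Real.log_abs]
          refine Real.log_nonpos (abs_nonneg _) ?_
          rw [abs_le]; constructor <;> linarith [ht.1, ht.2, hτ.1, hτ.2]
    _ ≤ 2 := by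
        rw [integral_neg, integral_Icc_eq_integral_Ioc, ← intervalIntegral.integral_of_le zero_le_one]
        exact ENNReal.ofReal_le_of_le_toReal (by simpa using hval)

/-- Anti-concentration in one variable: averaging over the unit interval the logarithm of the
modulus of an affine function loses at most a logarithm of `Y`, compared with its value at any
complex point of modulus at most `Y`. -/
theorem lintegral_sub_log_norm_affine_le (p q y : ℂ) {Y B : ℝ} (hy : ‖y‖ ≤ Y)
    (hne : p + y * q ≠ 0) (hB : Real.log ‖p + y * q‖ ≤ B) :
    (∀ᵐ t : unitInterval, p + ((t : ℝ) : ℂ) * q ≠ 0) ∧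
      ∫⁻ t : unitInterval, ENNReal.ofReal (B - Real.log ‖p + ((t : ℝ) : ℂ) * q‖) ≤
        ENNReal.ofReal (B - Real.log ‖p + y * q‖) + ENNReal.ofReal (Real.log (Y + 2) + 2) := by
  obtain ⟨τ, hτ, h⟩ := exists_mul_abs_sub_le_norm_affine p q y hy
  have hY : 0 ≤ Y := (norm_nonneg y).trans hy
  have hτne : ∀ᵐ t : unitInterval, (t : ℝ) ≠ τ := by
    have : ({⟨τ, hτ⟩}ᶜ : Set unitInterval) ∈ ae (volume : Measure unitInterval) :=
      compl_mem_ae_iff.2 (measure_singleton _)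
    filter_upwards [this] with t ht h
    exact ht (by simp [← h])
  have hpos : ∀ t : unitInterval, (t : ℝ) ≠ τ → 0 < ‖p + y * q‖ * |(t : ℝ) - τ| := fun t ht =>
    mul_pos (norm_pos_iff.2 hne) (abs_pos.2 (sub_ne_zero.2 ht))
  have hnz : ∀ t : unitInterval, (t : ℝ) ≠ τ → 0 < ‖p + ((t : ℝ) : ℂ) * q‖ := fun t ht => by
    have := (hpos t ht).trans_le (h t t.2)
    exact pos_of_mul_pos_right this (by linarith)
  have hlog : 0 ≤ Real.log (Y + 2) := Real.log_nonneg (by linarith)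
  refine ⟨hτne.mono fun t ht => norm_pos_iff.1 (hnz t ht), ?_⟩
  calc ∫⁻ t : unitInterval, ENNReal.ofReal (B - Real.log ‖p + ((t : ℝ) : ℂ) * q‖)
      ≤ ∫⁻ t : unitInterval, (ENNReal.ofReal (B - Real.log ‖p + y * q‖ + Real.log (Y + 2))
          + ENNReal.ofReal (-Real.log |(t : ℝ) - τ|)) := by
        refine lintegral_mono_ae (hτne.mono fun t ht => ?_)
        refine le_trans (ENNReal.ofReal_le_ofReal ?_) ENNReal.ofReal_add_le
        have h1 := Real.log_le_log (hpos t ht) (h t t.2)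
        rw [Real.log_mul (norm_ne_zero_iff.2 hne) (abs_pos.2 (sub_ne_zero.2 ht)).ne',
          Real.log_mul (by linarith) (hnz t ht).ne'] at h1
        linarith
    _ = ENNReal.ofReal (B - Real.log ‖p + y * q‖ + Real.log (Y + 2)) +
          ∫⁻ t : unitInterval, ENNReal.ofReal (-Real.log |(t : ℝ) - τ|) := by
        rw [lintegral_add_left measurable_const]; simp
    _ ≤ ENNReal.ofReal (B - Real.log ‖p + y * q‖ + Real.log (Y + 2)) + 2 := by
        gcongr; exact lintegral_neg_log_abs_sub_le hτ
    _ = _ := by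
        rw [ENNReal.ofReal_add (by linarith) hlog, ENNReal.ofReal_add hlog zero_le_two, add_assoc]
        simp

/-- A function on `ℂⁿ` that is affine in each coordinate separately. -/
def IsMultiAffine {n : ℕ} (f : (Fin n → ℂ) → ℂ) : Prop :=
  ∀ x i, ∃ p q : ℂ, ∀ t, f (Function.update x i t) = p + t * q

/-- The real point with coordinates in the unit interval, viewed in `ℂⁿ`. -/
def cubePoint {n : ℕ} (t : Fin n → unitInterval) : Fin n → ℂ := fun i => ((t i : ℝ) : ℂ)

theorem continuous_cubePoint {n : ℕ} : Continuous (cubePoint (n := n)) := by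
  unfold cubePoint; fun_prop

/-- Induction on the number of variables, one coordinate of `y` at a time being replaced by a uniform
variable. The upper bound `B` makes the integrands non-negative, so that no integrability is needed
beforehand; the non-vanishing is stated separately because `Real.log 0 = 0`. -/
theorem IsMultiAffine.ae_ne_zero_and_lintegral_le {Y B : ℝ} (hY : 1 ≤ Y) :
    ∀ {n : ℕ} {f : (Fin n → ℂ) → ℂ} (_ : IsMultiAffine f) (_ : Continuous f)
      (_ : ∀ x, (∀ i, ‖x i‖ ≤ Y) → Real.log ‖f x‖ ≤ B) {y : Fin n → ℂ}
      (_ : ∀ i, ‖y i‖ ≤ Y) (_ : f y ≠ 0),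
      (∀ᵐ t : Fin n → unitInterval, f (cubePoint t) ≠ 0) ∧
      ∫⁻ t : Fin n → unitInterval, ENNReal.ofReal (B - Real.log ‖f (cubePoint t)‖) ≤
        ENNReal.ofReal (B - Real.log ‖f y‖) + n * ENNReal.ofReal (Real.log (Y + 2) + 2) := by
  intro n
  induction n with
  | zero =>
    intro f hf hc hB y hy hne
    have : ∀ t : Fin 0 → unitInterval, cubePoint t = y := fun t => Subsingleton.elim _ _
    simp [this, hne]
  | succ n ih =>
    intro f hf hc hB y hy hne
    set g : (Fin n → ℂ) → ℂ := fun x => f (Fin.cons (y 0) x) with hg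
    have hgY : g (Fin.tail y) = f y := by simp [hg]
    have hgc : Continuous g := hc.comp (by fun_prop)
    have hgaff : IsMultiAffine g := fun x i => by
      obtain ⟨p, q, h⟩ := hf (Fin.cons (y 0) x) i.succ
      exact ⟨p, q, fun t => by simp only [hg]; rw [Fin.cons_update, h]⟩
    have hcons : ∀ {a : ℂ} {x : Fin n → ℂ}, ‖a‖ ≤ Y → (∀ i, ‖x i‖ ≤ Y) →
        ∀ i, ‖(Fin.cons a x : Fin (n + 1) → ℂ) i‖ ≤ Y := fun ha hx i => by
      refine Fin.cases ?_ (fun j => ?_) i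
      · simpa using ha
      · simpa using hx j
    obtain ⟨ih1, ih2⟩ := ih hgaff hgc (fun x hx => hB _ (hcons (hy 0) hx))
      (y := Fin.tail y) (fun i => hy _) (by rwa [hgY])
    rw [hgY] at ih2
    have hcube : ∀ (t : unitInterval) (x : Fin n → unitInterval),
        cubePoint (Fin.cons t x : Fin (n + 1) → unitInterval) = Fin.cons ((t : ℝ) : ℂ) (cubePoint x) := by
      intro t x; funext i; refine Fin.cases ?_ (fun j => ?_) i <;> simp [cubePoint]
    have hcubeY : ∀ (x : Fin n → unitInterval) i, ‖cubePoint x i‖ ≤ Y := fun x i => by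
      simp only [cubePoint, Complex.norm_real]
      rw [Real.norm_of_nonneg (x i).2.1]; exact (x i).2.2.trans hY
    -- for a fixed value of the remaining coordinates, the one-variable bound
    have hone : ∀ x : Fin n → unitInterval, g (cubePoint x) ≠ 0 →
        (∀ᵐ t : unitInterval, f (Fin.cons ((t : ℝ) : ℂ) (cubePoint x)) ≠ 0) ∧
        ∫⁻ t : unitInterval, ENNReal.ofReal
          (B - Real.log ‖f (Fin.cons ((t : ℝ) : ℂ) (cubePoint x))‖) ≤
        ENNReal.ofReal (B - Real.log ‖g (cubePoint x)‖) +
          ENNReal.ofReal (Real.log (Y + 2) + 2) := fun x hx => by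
      obtain ⟨p, q, h⟩ := hf (Fin.cons 0 (cubePoint x)) 0
      have h' : ∀ t : ℂ, f (Fin.cons t (cubePoint x)) = p + t * q := fun t => by
        rw [← h, Fin.update_cons_zero]
      simp only [hg, h'] at hx ⊢
      refine lintegral_sub_log_norm_affine_le p q (y 0) (hy 0) hx ?_
      rw [← h']; exact hB _ (hcons (hy 0) (hcubeY x))
    have hmp := (volume_preserving_piFinSuccAbove (fun _ : Fin (n + 1) => unitInterval) 0).symm
    have hsymm : ∀ z : unitInterval × (Fin n → unitInterval),
        (MeasurableEquiv.piFinSuccAbove (fun _ : Fin (n + 1) => unitInterval) 0).symm z =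
          Fin.cons z.1 z.2 := fun z => by
      simp [MeasurableEquiv.piFinSuccAbove, Fin.insertNthEquiv]
    have hmeas : Measurable fun z : unitInterval × (Fin n → unitInterval) =>
        f (Fin.cons ((z.1 : ℝ) : ℂ) (cubePoint z.2)) := by
      refine (hc.comp ?_).measurable
      refine continuous_pi fun i => ?_
      refine Fin.cases ?_ (fun j => ?_) i
      · simp only [Fin.cons_zero]; fun_prop
      · simp only [Fin.cons_succ, cubePoint]; fun_prop
    constructor
    · rw [← hmp.map_eq]
      have hms : MeasurableSet {t : Fin (n + 1) → unitInterval | f (cubePoint t) ≠ 0} :=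
        ((hc.comp continuous_cubePoint).measurable (measurableSet_singleton 0)).compl
      rw [ae_map_iff hmp.measurable.aemeasurable hms]
      simp only [hsymm, hcube]
      rw [Measure.volume_eq_prod]
      have h2 : MeasurableSet {z : unitInterval × (Fin n → unitInterval) |
          f (Fin.cons ((z.1 : ℝ) : ℂ) (cubePoint z.2)) ≠ 0} :=
        (hmeas (measurableSet_singleton 0)).compl
      rw [← Measure.prod_swap, ae_map_iff measurable_swap.aemeasurable h2]
      refine (Measure.ae_prod_iff_ae_ae (measurable_swap h2)).2 ?_
      filter_upwards [ih1] with x hx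
      exact (hone x hx).1
    · rw [← hmp.lintegral_comp_emb (MeasurableEquiv.measurableEmbedding _)]
      simp only [hsymm, hcube]
      rw [Measure.volume_eq_prod, lintegral_prod_symm']
      · calc _ ≤ ∫⁻ x : Fin n → unitInterval, (ENNReal.ofReal (B - Real.log ‖g (cubePoint x)‖) +
              ENNReal.ofReal (Real.log (Y + 2) + 2)) :=
            lintegral_mono_ae (ih1.mono fun x hx => (hone x hx).2)
          _ = (∫⁻ x : Fin n → unitInterval, ENNReal.ofReal (B - Real.log ‖g (cubePoint x)‖)) +
              ENNReal.ofReal (Real.log (Y + 2) + 2) := by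
            rw [lintegral_add_right _ measurable_const]; simp
          _ ≤ _ := by
            refine (add_le_add_left ih2 _).trans (le_of_eq ?_)
            push_cast; ring
      · exact ENNReal.measurable_ofReal.comp
          (measurable_const.sub (Real.measurable_log.comp hmeas.norm))

theorem exists_log_norm_le {n : ℕ} {f : (Fin n → ℂ) → ℂ} (hc : Continuous f) (Y : ℝ) :
    ∃ B : ℝ, ∀ x : Fin n → ℂ, (∀ i, ‖x i‖ ≤ Y) → Real.log ‖f x‖ ≤ B := by
  obtain ⟨C, hC⟩ := (isCompact_univ_pi fun _ : Fin n =>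
    isCompact_closedBall (0 : ℂ) Y).exists_bound_of_continuousOn hc.continuousOn
  exact ⟨C, fun x hx => (Real.log_le_self (norm_nonneg _)).trans (hC x (by simpa using hx))⟩

/-- Anti-concentration for multi-affine functions of independent uniform variables: the average of
`log |f|` over the unit cube is at least `log |f y|`, up to an error that is logarithmic in the size
of the coordinates of the complex point `y`. If moreover `log |f|` is at most `log |f y| + A` on the
cube, then `log |f|` is close to `log |f y|` in mean. -/
theorem IsMultiAffine.lintegral_abs_log_sub_le {n : ℕ} {f : (Fin n → ℂ) → ℂ}
    (hf : IsMultiAffine f) (hc : Continuous f) {Y A : ℝ} (hY : 1 ≤ Y) (hA : 0 ≤ A)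
    {y : Fin n → ℂ} (hy : ∀ i, ‖y i‖ ≤ Y) (hne : f y ≠ 0)
    (hup : ∀ t : Fin n → unitInterval, ‖f (cubePoint t)‖ ≤ Real.exp A * ‖f y‖) :
    ∫⁻ t : Fin n → unitInterval, ‖Real.log ‖f (cubePoint t)‖ - Real.log ‖f y‖‖ₑ ≤
      ENNReal.ofReal (2 * A + n * (Real.log (Y + 2) + 2)) := by
  have hpos : 0 < ‖f y‖ := norm_pos_iff.2 hne
  obtain ⟨B, hB⟩ := exists_log_norm_le hc Y
  obtain ⟨h1, h2⟩ := hf.ae_ne_zero_and_lintegral_le hY hc hB hy hne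
  have hcubeY : ∀ (x : Fin n → unitInterval) i, ‖cubePoint x i‖ ≤ Y := fun x i => by
    simp only [cubePoint, Complex.norm_real]
    rw [Real.norm_of_nonneg (x i).2.1]; exact (x i).2.2.trans hY
  have hBy : Real.log ‖f y‖ ≤ B := hB y hy
  have hmeas : Measurable fun t : Fin n → unitInterval => Real.log ‖f (cubePoint t)‖ :=
    Real.measurable_log.comp (hc.comp continuous_cubePoint).measurable.norm
  have hc0 : 0 ≤ Real.log (Y + 2) + 2 := add_nonneg (Real.log_nonneg (by linarith)) zero_le_two
  have hnc : 0 ≤ n * (Real.log (Y + 2) + 2) := by positivity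
  -- the bound above, for real integrals
  have hint : Integrable fun t : Fin n → unitInterval => B - Real.log ‖f (cubePoint t)‖ := by
    refine ⟨(measurable_const.sub hmeas).aestronglyMeasurable, ?_⟩
    rw [hasFiniteIntegral_iff_ofReal (Eventually.of_forall fun t => sub_nonneg.2 (hB _ (hcubeY t)))]
    refine h2.trans_lt ?_
    finiteness
  have hle : ∫ t : Fin n → unitInterval, (B - Real.log ‖f (cubePoint t)‖) ≤
      B - Real.log ‖f y‖ + n * (Real.log (Y + 2) + 2) := by
    rw [← ofReal_integral_eq_lintegral_ofReal hint
      (Eventually.of_forall fun t => sub_nonneg.2 (hB _ (hcubeY t)))] at h2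
    rw [← ENNReal.ofReal_natCast, ← ENNReal.ofReal_mul (by positivity),
      ← ENNReal.ofReal_add (by linarith) hnc] at h2
    exact (ENNReal.ofReal_le_ofReal_iff (by linarith)).1 h2
  calc ∫⁻ t : Fin n → unitInterval, ‖Real.log ‖f (cubePoint t)‖ - Real.log ‖f y‖‖ₑ
      ≤ ∫⁻ t : Fin n → unitInterval, ENNReal.ofReal
          (2 * A + Real.log ‖f y‖ - Real.log ‖f (cubePoint t)‖) := by
        refine lintegral_mono_ae (h1.mono fun t ht => ?_)
        rw [Real.enorm_eq_ofReal_abs]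
        apply ENNReal.ofReal_le_ofReal
        have h3 := Real.log_le_log (norm_pos_iff.2 ht) (hup t)
        rw [Real.log_mul (Real.exp_ne_zero _) hpos.ne', Real.log_exp] at h3
        rw [abs_le]; constructor <;> linarith
    _ = ENNReal.ofReal (∫ t : Fin n → unitInterval,
          (2 * A + Real.log ‖f y‖ - Real.log ‖f (cubePoint t)‖)) := by
        rw [ofReal_integral_eq_lintegral_ofReal]
        · have : (fun t : Fin n → unitInterval =>
              2 * A + Real.log ‖f y‖ - Real.log ‖f (cubePoint t)‖) = fun t =>
              (2 * A + Real.log ‖f y‖ - B) + (B - Real.log ‖f (cubePoint t)‖) := by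
            funext t; ring
          rw [this]
          exact (integrable_const _).add hint
        · filter_upwards [h1] with t ht
          have h3 := Real.log_le_log (norm_pos_iff.2 ht) (hup t)
          rw [Real.log_mul (Real.exp_ne_zero _) hpos.ne', Real.log_exp] at h3
          simp only [Pi.zero_apply]; linarith
    _ ≤ _ := by
        apply ENNReal.ofReal_le_ofReal
        have : (fun t : Fin n → unitInterval =>
              2 * A + Real.log ‖f y‖ - Real.log ‖f (cubePoint t)‖) = fun t =>
              (2 * A + Real.log ‖f y‖ - B) + (B - Real.log ‖f (cubePoint t)‖) := by
            funext t; ring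
        rw [this, integral_add (integrable_const _) hint]
        simp only [integral_const, probReal_univ, one_smul]
        linarith

/-- A multi-affine function that does not vanish identically on `ℂⁿ` is almost everywhere non-zero on
the real unit cube. -/
theorem IsMultiAffine.ae_ne_zero {n : ℕ} {f : (Fin n → ℂ) → ℂ}
    (hf : IsMultiAffine f) (hc : Continuous f) {y : Fin n → ℂ} (hne : f y ≠ 0) :
    ∀ᵐ t : Fin n → unitInterval, f (cubePoint t) ≠ 0 := by
  set Y : ℝ := 1 + ∑ i, ‖y i‖
  have hY : 1 ≤ Y := by
    have : 0 ≤ ∑ i, ‖y i‖ := Finset.sum_nonneg fun i _ => norm_nonneg _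
    linarith
  have hy : ∀ i, ‖y i‖ ≤ Y := fun i => by
    have := Finset.single_le_sum (f := fun i => ‖y i‖) (fun i _ => norm_nonneg _) (Finset.mem_univ i)
    linarith
  obtain ⟨B, hB⟩ := exists_log_norm_le hc Y
  exact (hf.ae_ne_zero_and_lintegral_le hY hc hB hy hne).1

/-! ### Circulant matrices and their symbols -/

/-- The primitive `N`-th root of unity `exp (2πi / N)`. -/
noncomputable def rootOfUnity (N : ℕ) : ℂ := Complex.exp (2 * Real.pi * Complex.I / N)

theorem isPrimitiveRoot_rootOfUnity {N : ℕ} (hN : N ≠ 0) : IsPrimitiveRoot (rootOfUnity N) N :=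
  Complex.isPrimitiveRoot_exp N hN

theorem rootOfUnity_ne_zero (N : ℕ) : rootOfUnity N ≠ 0 := Complex.exp_ne_zero _

theorem norm_rootOfUnity {N : ℕ} (hN : N ≠ 0) : ‖rootOfUnity N‖ = 1 :=
  (isPrimitiveRoot_rootOfUnity hN).norm'_eq_one hN

theorem sum_rootOfUnity_zpow {N : ℕ} (hN : N ≠ 0) (m : ℤ) :
    ∑ k : Fin N, rootOfUnity N ^ ((k : ℤ) * m) = if (N : ℤ) ∣ m then (N : ℂ) else 0 := by
  have hζ := isPrimitiveRoot_rootOfUnity hN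
  have h1 : ∀ k : Fin N, rootOfUnity N ^ ((k : ℤ) * m) = (rootOfUnity N ^ m) ^ (k : ℕ) := fun k => by
    rw [mul_comm, zpow_mul, zpow_natCast]
  simp_rw [h1]
  rw [Fin.sum_univ_eq_sum_range (fun k => (rootOfUnity N ^ m) ^ k) N]
  split_ifs with h
  · rw [(hζ.zpow_eq_one_iff_dvd m).2 h]; simp
  · have h2 : rootOfUnity N ^ m ≠ 1 := fun h' => h ((hζ.zpow_eq_one_iff_dvd m).1 h')
    rw [geom_sum_eq h2]
    have : (rootOfUnity N ^ m) ^ N = 1 := by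
      rw [← zpow_natCast, zpow_comm, zpow_natCast, hζ.pow_eq_one, one_zpow]
    rw [this, sub_self, zero_div]

/-- The matrix of the discrete Fourier transform, up to normalization. -/
noncomputable def fourierMatrix (N : ℕ) : Matrix (Fin N) (Fin N) ℂ :=
  Matrix.of fun i k => rootOfUnity N ^ ((k : ℤ) * (i : ℤ))

/-- The inverse of `fourierMatrix N`. -/
noncomputable def fourierMatrixInv (N : ℕ) : Matrix (Fin N) (Fin N) ℂ :=
  Matrix.of fun k j => (N : ℂ)⁻¹ * rootOfUnity N ^ (-((k : ℤ) * (j : ℤ)))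

/-- The circulant matrix with eigenvalues `g k`, with the discrete Fourier basis as eigenvectors. -/
noncomputable def spectralCirculant {N : ℕ} (g : Fin N → ℂ) : Matrix (Fin N) (Fin N) ℂ :=
  fourierMatrix N * Matrix.diagonal g * fourierMatrixInv N

theorem spectralCirculant_apply {N : ℕ} (g : Fin N → ℂ) (i j : Fin N) :
    spectralCirculant g i j =
      (N : ℂ)⁻¹ * ∑ k, g k * rootOfUnity N ^ ((k : ℤ) * ((i : ℤ) - (j : ℤ))) := by
  rw [spectralCirculant, Matrix.mul_apply, Finset.mul_sum]
  refine Finset.sum_congr rfl fun k _ => ?_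
  rw [Matrix.mul_diagonal, mul_sub, sub_eq_add_neg, zpow_add₀ (rootOfUnity_ne_zero N)]
  simp only [fourierMatrix, fourierMatrixInv, Matrix.of_apply]
  ring

theorem fourierMatrix_mul_inv (N : ℕ) : fourierMatrix N * fourierMatrixInv N = 1 := by
  rcases eq_or_ne N 0 with rfl | hN
  · exact Subsingleton.elim _ _
  ext i j
  have h : (fourierMatrix N * fourierMatrixInv N) i j = spectralCirculant (fun _ => 1) i j := by
    simp [spectralCirculant]
  rw [h, spectralCirculant_apply]
  simp only [one_mul]
  rw [sum_rootOfUnity_zpow hN]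
  have hN' : (N : ℂ) ≠ 0 := by exact_mod_cast hN
  by_cases hij : i = j
  · subst hij; simp [hN']
  · have : ¬ (N : ℤ) ∣ (i : ℤ) - j := fun hd => hij <| by
      have h1 := Int.eq_zero_of_abs_lt_dvd hd (by rw [abs_lt]; omega)
      omega
    rw [if_neg this, Matrix.one_apply_ne hij, mul_zero]

theorem fourierMatrixInv_mul (N : ℕ) : fourierMatrixInv N * fourierMatrix N = 1 :=
  mul_eq_one_comm.1 (fourierMatrix_mul_inv N)

theorem spectralCirculant_mul {N : ℕ} (g h : Fin N → ℂ) :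
    spectralCirculant g * spectralCirculant h = spectralCirculant (g * h) := by
  unfold spectralCirculant
  calc _ = fourierMatrix N * Matrix.diagonal g * (fourierMatrixInv N * fourierMatrix N) *
        Matrix.diagonal h * fourierMatrixInv N := by simp only [Matrix.mul_assoc]
    _ = _ := by
        rw [fourierMatrixInv_mul, Matrix.mul_one, Matrix.mul_assoc (fourierMatrix N),
          Matrix.diagonal_mul_diagonal]
        rfl

theorem spectralCirculant_one {N : ℕ} : spectralCirculant (1 : Fin N → ℂ) = 1 := by
  simp [spectralCirculant, fourierMatrix_mul_inv]

theorem det_spectralCirculant {N : ℕ} (g : Fin N → ℂ) : (spectralCirculant g).det = ∏ k, g k := by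
  have h := congrArg Matrix.det (fourierMatrix_mul_inv N)
  rw [Matrix.det_mul, Matrix.det_one] at h
  rw [spectralCirculant, Matrix.det_mul, Matrix.det_mul, Matrix.det_diagonal,
    mul_right_comm, h, one_mul]

theorem spectralCirculant_const_sub {N : ℕ} (z : ℂ) (g : Fin N → ℂ) :
    spectralCirculant (fun k => z - g k) = z • 1 - spectralCirculant g := by
  have : Matrix.diagonal (fun k => z - g k) = z • (1 : Matrix (Fin N) (Fin N) ℂ) -
      Matrix.diagonal g := by
    rw [Matrix.smul_one_eq_diagonal, Matrix.diagonal_sub]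
  rw [spectralCirculant, this, Matrix.mul_sub, Matrix.sub_mul]
  simp [spectralCirculant, fourierMatrix_mul_inv]

theorem norm_spectralCirculant_apply_le {N : ℕ} (hN : N ≠ 0) {g : Fin N → ℂ} {κ : ℝ}
    (hg : ∀ k, ‖g k‖ ≤ κ) (i j : Fin N) : ‖spectralCirculant g i j‖ ≤ κ := by
  have hN' : (0 : ℝ) < N := by exact_mod_cast Nat.pos_of_ne_zero hN
  rw [spectralCirculant_apply, norm_mul, norm_inv, Complex.norm_natCast]
  rw [inv_mul_le_iff₀ hN']
  refine (norm_sum_le _ _).trans ?_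
  calc _ ≤ ∑ k : Fin N, κ := Finset.sum_le_sum fun k _ => by
        rw [norm_mul, norm_zpow, norm_rootOfUnity hN, one_zpow, mul_one]; exact hg k
    _ = _ := by simp

/-- The sum of the moduli of the coefficients of a Laurent polynomial. -/
noncomputable def coeffNorm (a : ℂ[T;T⁻¹]) : ℝ := ∑ m ∈ a.coeff.support, ‖a.coeff m‖

theorem coeffNorm_nonneg (a : ℂ[T;T⁻¹]) : 0 ≤ coeffNorm a :=
  Finset.sum_nonneg fun _ _ => norm_nonneg _

theorem symbol_eq_sum (a : ℂ[T;T⁻¹]) (w : ℂ) :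
    symbol a w = ∑ m ∈ a.coeff.support, a.coeff m * w ^ m := rfl

theorem norm_symbol_le (a : ℂ[T;T⁻¹]) {w : ℂ} (hw : ‖w‖ = 1) : ‖symbol a w‖ ≤ coeffNorm a := by
  rw [symbol_eq_sum]
  refine (norm_sum_le _ _).trans (Finset.sum_le_sum fun m _ => ?_)
  rw [norm_mul, norm_zpow, hw, one_zpow, mul_one]

/-- The `N × N` circulant matrix with symbol `a`; its eigenvalues are the values of the symbol at
the `N`-th roots of unity. -/
noncomputable def symbolCirculant (a : ℂ[T;T⁻¹]) (N : ℕ) : Matrix (Fin N) (Fin N) ℂ :=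
  spectralCirculant fun k : Fin N => symbol a (rootOfUnity N ^ (k : ℕ))

theorem symbolCirculant_apply (a : ℂ[T;T⁻¹]) {N : ℕ} (i j : Fin N) :
    symbolCirculant a N i j =
      ∑ m ∈ a.coeff.support, a.coeff m * if (N : ℤ) ∣ m + ((i : ℤ) - j) then 1 else 0 := by
  have hN : N ≠ 0 := by have := i.2; omega
  have hN' : (N : ℂ) ≠ 0 := by exact_mod_cast hN
  rw [symbolCirculant, spectralCirculant_apply]
  simp only [symbol_eq_sum, Finset.sum_mul]
  rw [Finset.sum_comm, Finset.mul_sum]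
  refine Finset.sum_congr rfl fun m _ => ?_
  have h1 : ∀ k : Fin N, a.coeff m * (rootOfUnity N ^ (k : ℕ)) ^ m *
      rootOfUnity N ^ ((k : ℤ) * ((i : ℤ) - j)) =
      a.coeff m * rootOfUnity N ^ ((k : ℤ) * (m + ((i : ℤ) - j))) := fun k => by
    rw [mul_add (k : ℤ), zpow_add₀ (rootOfUnity_ne_zero N), zpow_mul _ (k : ℤ) m, zpow_natCast,
      mul_assoc]
  simp_rw [h1]
  rw [← Finset.mul_sum, sum_rootOfUnity_zpow hN]
  split_ifs
  · field_simp
  · simp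

theorem toeplitz_apply_eq_sum (a : ℂ[T;T⁻¹]) {N : ℕ} (i j : Fin N) :
    toeplitz a N i j =
      ∑ m ∈ a.coeff.support, a.coeff m * if m + ((i : ℤ) - j) = 0 then 1 else 0 := by
  have h : ∀ m : ℤ, (m + ((i : ℤ) - j) = 0) ↔ m = (j : ℤ) - i := fun m => by omega
  simp only [toeplitz, Matrix.of_apply, h, mul_ite, mul_one, mul_zero, Finset.sum_ite_eq']
  split_ifs with h'
  · rfl
  · simpa using h'

/-- Each coefficient `a m` contributes at most once, since an entry of the circulant matrix sums the
coefficients in one residue class and that of the Toeplitz matrix is one of them. -/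
theorem norm_symbolCirculant_sub_toeplitz_apply_le (a : ℂ[T;T⁻¹]) {N : ℕ} (i j : Fin N) :
    ‖(symbolCirculant a N - toeplitz a N) i j‖ ≤ coeffNorm a := by
  rw [Matrix.sub_apply, symbolCirculant_apply, toeplitz_apply_eq_sum, ← Finset.sum_sub_distrib]
  refine (norm_sum_le _ _).trans (Finset.sum_le_sum fun m _ => ?_)
  rw [← mul_sub, norm_mul]
  refine mul_le_of_le_one_right (norm_nonneg _) ?_
  split_ifs with h1 h2 h2 <;> simp_all

/-- The Toeplitz matrix and the circulant matrix with the same symbol differ only in the corners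
that carry the perturbation. -/
theorem symbolCirculant_sub_toeplitz_apply_eq_zero {a : ℂ[T;T⁻¹]} {d₁ d₂ : ℕ}
    (ha : ∀ k : ℤ, a.coeff k ≠ 0 → -(d₂ : ℤ) ≤ k ∧ k ≤ (d₁ : ℤ)) {N : ℕ}
    (h₁ : d₁ ≤ N) (h₂ : d₂ ≤ N) {i j : Fin N} (hij : ¬ InCorner d₁ d₂ N i j) :
    (symbolCirculant a N - toeplitz a N) i j = 0 := by
  rw [Matrix.sub_apply, symbolCirculant_apply, toeplitz_apply_eq_sum, ← Finset.sum_sub_distrib]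
  refine Finset.sum_eq_zero fun m hm => ?_
  obtain ⟨hm2, hm1⟩ := ha m (by simpa using hm)
  have hi := i.2
  have hj := j.2
  suffices h : (N : ℤ) ∣ m + ((i : ℤ) - j) ↔ m + ((i : ℤ) - j) = 0 by
    rw [← mul_sub]; simp [h]
  refine ⟨fun ⟨q, hq⟩ => ?_, fun h => h ▸ dvd_zero _⟩
  by_contra hne
  refine hij ?_
  have hq0 : q ≠ 0 := by rintro rfl; simp_all
  -- the bounds on `m`, `i` and `j` leave only the values `q = 1` and `q = -1`
  have hNpos : (0 : ℤ) < N := by omega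
  have hq2 : q < 2 := by
    by_contra! hq2
    have : (N : ℤ) * 2 ≤ N * q := mul_le_mul_of_nonneg_left hq2 hNpos.le
    omega
  have hq3 : -2 < q := by
    by_contra! hq2
    have : (N : ℤ) * q ≤ N * (-2) := mul_le_mul_of_nonneg_left hq2 hNpos.le
    omega
  obtain rfl | rfl : q = 1 ∨ q = -1 := by omega
  · exact Or.inl ⟨m.toNat, by omega, by omega, by omega⟩
  · exact Or.inr ⟨(-m).toNat, by omega, by omega, by omega⟩

/-! ### Determinants as functions of the corner entries -/

/-- Perturbing an invertible matrix in few columns changes the determinant by a factor that is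
polynomial in the size of the matrix. -/
theorem norm_det_add_le {N r : ℕ} {C C' E : Matrix (Fin N) (Fin N) ℂ} (hC : C * C' = 1)
    {κ e : ℝ} (hκ : ∀ i j, ‖C' i j‖ ≤ κ) (he : ∀ i j, ‖E i j‖ ≤ e) (hκ0 : 0 ≤ κ) (he0 : 0 ≤ e)
    (J : Finset (Fin N)) (hJ : J.card ≤ r) (hE : ∀ i j, j ∉ J → E i j = 0) :
    ‖(C + E).det‖ ≤ r.factorial * (1 + N * (κ * e)) ^ r * ‖C.det‖ := by
  classical
  have h1 : C + E = C * (1 + C' * E) := by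
    rw [Matrix.mul_add, Matrix.mul_one, ← Matrix.mul_assoc, hC, Matrix.one_mul]
  set G := C' * E with hG
  have hGJ : ∀ i j, j ∉ J → G i j = 0 := fun i j hj => by
    rw [hG, Matrix.mul_apply]
    exact Finset.sum_eq_zero fun k _ => by rw [hE k j hj, mul_zero]
  have hGn : ∀ i j, ‖G i j‖ ≤ N * (κ * e) := fun i j => by
    rw [hG, Matrix.mul_apply]
    refine (norm_sum_le _ _).trans ?_
    calc _ ≤ ∑ k : Fin N, κ * e := Finset.sum_le_sum fun k _ => by
          rw [norm_mul]; exact mul_le_mul (hκ _ _) (he _ _) (norm_nonneg _) hκ0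
      _ = _ := by simp
  have hG2 : G = G.submatrix id (Subtype.val : J → Fin N) *
      (1 : Matrix (Fin N) (Fin N) ℂ).submatrix (Subtype.val : J → Fin N) id := by
    ext i j
    simp only [Matrix.mul_apply, Matrix.submatrix_apply, id, Matrix.one_apply, mul_ite, mul_one,
      mul_zero]
    rw [Finset.sum_coe_sort J (fun x => if x = j then G i x else 0), Finset.sum_ite_eq']
    split_ifs with h
    · rfl
    · exact hGJ i j h
  have hdet : (1 + G).det = (1 + G.submatrix (Subtype.val : J → Fin N) Subtype.val).det := by
    conv_lhs => rw [hG2]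
    rw [Matrix.det_one_add_mul_comm]
    congr 2
    ext i j
    simp [Matrix.mul_apply, Matrix.one_apply]
  have hx : 1 ≤ 1 + N * (κ * e) := by
    have : 0 ≤ N * (κ * e) := by positivity
    linarith
  have hle : ‖(1 + G).det‖ ≤ r.factorial * (1 + N * (κ * e)) ^ r := by
    rw [hdet]
    refine (Matrix.det_le (abv := NormedField.toAbsoluteValue ℂ) (x := 1 + N * (κ * e))
      fun i j => ?_).trans ?_
    · change ‖(1 + G.submatrix (Subtype.val : J → Fin N) Subtype.val) i j‖ ≤ _
      rw [Matrix.add_apply]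
      refine (norm_add_le _ _).trans (add_le_add ?_ (hGn _ _))
      rw [Matrix.one_apply]; split_ifs <;> simp
    · rw [nsmul_eq_mul, Fintype.card_coe]
      gcongr
  rw [h1, Matrix.det_mul, norm_mul, mul_comm]
  gcongr

/-- The columns that meet the corners. -/
def cornerColumns (d₁ d₂ N : ℕ) : Finset (Fin N) :=
  Finset.univ.filter fun j => (j : ℕ) < d₁ ∨ N ≤ j + d₂

theorem card_cornerColumns_le (d₁ d₂ N : ℕ) : (cornerColumns d₁ d₂ N).card ≤ d₁ + d₂ := by
  rw [cornerColumns, Finset.filter_or]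
  refine (Finset.card_union_le _ _).trans (add_le_add ?_ ?_)
  · have := Finset.card_le_card_of_injOn (s := Finset.univ.filter fun j : Fin N => (j : ℕ) < d₁)
      (t := Finset.range d₁) Fin.val (fun j hj => by simpa using hj) Fin.val_injective.injOn
    simpa using this
  · have := Finset.card_le_card_of_injOn (s := Finset.univ.filter fun j : Fin N => N ≤ j + d₂)
      (t := Finset.Ico (N - d₂) N) Fin.val (fun j hj => by
        have h1 : N ≤ (j : ℕ) + d₂ := by simpa using hj
        have h2 := j.2
        simp only [Finset.coe_Ico, Set.mem_Ico]; omega) Fin.val_injective.injOn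
    rw [Nat.card_Ico] at this
    omega

theorem InCorner.col_mem {d₁ d₂ N : ℕ} {i j : Fin N} (h : InCorner d₁ d₂ N i j) :
    j ∈ cornerColumns d₁ d₂ N := by
  simp only [cornerColumns, Finset.mem_filter, Finset.mem_univ, true_and]
  have hi := i.2
  have hj := j.2
  rcases h with ⟨l, h1, h2, h3⟩ | ⟨l, h1, h2, h3⟩ <;> omega

theorem InCorner.row_mem {d₁ d₂ N : ℕ} {i j : Fin N} (h : InCorner d₁ d₂ N i j) :
    i ∈ cornerColumns d₂ d₁ N := by
  simp only [cornerColumns, Finset.mem_filter, Finset.mem_univ, true_and]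
  have hi := i.2
  have hj := j.2
  rcases h with ⟨l, h1, h2, h3⟩ | ⟨l, h1, h2, h3⟩ <;> omega

/-- The positions in the two corners. -/
abbrev CornerIndex (d₁ d₂ N : ℕ) : Type := {p : Fin N × Fin N // InCorner d₁ d₂ N p.1 p.2}

noncomputable instance (d₁ d₂ N : ℕ) : Fintype (CornerIndex d₁ d₂ N) := Fintype.ofFinite _

theorem card_cornerIndex_le (d₁ d₂ N : ℕ) :
    Fintype.card (CornerIndex d₁ d₂ N) ≤ (d₁ + d₂) ^ 2 := by
  classical
  let g : CornerIndex d₁ d₂ N → (cornerColumns d₂ d₁ N) × (cornerColumns d₁ d₂ N) :=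
    fun p => (⟨p.1.1, p.2.row_mem⟩, ⟨p.1.2, p.2.col_mem⟩)
  have hg : Function.Injective g := fun p q h => by
    simp only [g, Prod.mk.injEq, Subtype.mk.injEq] at h
    exact Subtype.ext (Prod.ext h.1 h.2)
  refine (Fintype.card_le_of_injective g hg).trans ?_
  rw [Fintype.card_prod, Fintype.card_coe, Fintype.card_coe, pow_two]
  exact Nat.mul_le_mul (by rw [add_comm]; exact card_cornerColumns_le _ _ _)
    (card_cornerColumns_le _ _ _)

/-- An enumeration of the positions in the two corners. -/
noncomputable def cornerEquiv (d₁ d₂ N : ℕ) :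
    Fin (Fintype.card (CornerIndex d₁ d₂ N)) ≃ CornerIndex d₁ d₂ N :=
  (Fintype.equivFin _).symm

open Classical in
/-- The matrix with given complex entries in the two corners and zeros elsewhere. -/
noncomputable def cornerFill (d₁ d₂ N : ℕ) (x : Fin (Fintype.card (CornerIndex d₁ d₂ N)) → ℂ) :
    Matrix (Fin N) (Fin N) ℂ :=
  Matrix.of fun i j => if h : InCorner d₁ d₂ N i j
    then x ((cornerEquiv d₁ d₂ N).symm ⟨(i, j), h⟩) else 0

/-- The determinant of a matrix, as a function of its entries in the two corners. -/
noncomputable def cornerDet {d₁ d₂ N : ℕ} (M : Matrix (Fin N) (Fin N) ℂ) (s : ℂ)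
    (x : Fin (Fintype.card (CornerIndex d₁ d₂ N)) → ℂ) : ℂ :=
  (M - s • cornerFill d₁ d₂ N x).det

theorem continuous_cornerDet {d₁ d₂ N : ℕ} (M : Matrix (Fin N) (Fin N) ℂ) (s : ℂ) :
    Continuous (cornerDet (d₁ := d₁) (d₂ := d₂) M s) := by
  refine Continuous.matrix_det (continuous_const.sub (Continuous.const_smul ?_ s))
  refine continuous_matrix fun i j => ?_
  simp only [cornerFill, Matrix.of_apply]
  split_ifs <;> fun_prop

theorem isMultiAffine_cornerDet {d₁ d₂ N : ℕ} (M : Matrix (Fin N) (Fin N) ℂ) (s : ℂ) :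
    IsMultiAffine (cornerDet (d₁ := d₁) (d₂ := d₂) M s) := by
  intro x k
  set e := cornerEquiv d₁ d₂ N
  set i₀ := (e k).1.1 with hi
  set j₀ := (e k).1.2 with hj
  set M' := M - s • cornerFill d₁ d₂ N (Function.update x k 0) with hM'
  have key : ∀ t : ℂ, M - s • cornerFill d₁ d₂ N (Function.update x k t) =
      M'.updateRow i₀ (M' i₀ + t • Pi.single j₀ (-s)) := fun t => by
    ext i j
    have hent : ∀ u : ℂ, cornerFill d₁ d₂ N (Function.update x k u) i j =
        if i = i₀ ∧ j = j₀ then u else cornerFill d₁ d₂ N x i j := fun u => by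
      simp only [cornerFill, Matrix.of_apply]
      by_cases h : InCorner d₁ d₂ N i j
      · simp only [h, dif_pos, Function.update_apply]
        have : e.symm ⟨(i, j), h⟩ = k ↔ i = i₀ ∧ j = j₀ := by
          rw [Equiv.symm_apply_eq, Subtype.ext_iff, Prod.ext_iff]
        simp only [e] at this
        simp only [this]
      · have : ¬ (i = i₀ ∧ j = j₀) := fun h' => h (by rw [h'.1, h'.2]; exact (e k).2)
        simp [h, this]
    by_cases h1 : i = i₀
    · subst h1
      rw [Matrix.updateRow_self]
      by_cases h2 : j = j₀
      · subst h2
        simp only [hM', Matrix.sub_apply, Matrix.smul_apply, hent, Pi.add_apply, Pi.smul_apply]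
        simp
        ring
      · simp only [hM', Matrix.sub_apply, Matrix.smul_apply, hent, Pi.add_apply, Pi.smul_apply]
        simp [h2]
    · rw [Matrix.updateRow_ne h1]
      simp only [hM', Matrix.sub_apply, Matrix.smul_apply, hent]
      simp [h1]
  refine ⟨M'.det, (M'.updateRow i₀ (Pi.single j₀ (-s))).det, fun t => ?_⟩
  rw [cornerDet, key, Matrix.det_updateRow_add, Matrix.det_updateRow_smul, Matrix.updateRow_eq_self]

/-! ### Riemann sums -/

theorem tendsto_riemann_sum {g : ℝ → ℝ} (hg : Continuous g) {c : ℝ} (hc : 0 < c) :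
    Tendsto (fun N : ℕ => (N : ℝ)⁻¹ * ∑ k ∈ Finset.range N, g (c * k / N)) atTop
      (𝓝 (c⁻¹ * ∫ t in (0 : ℝ)..c, g t)) := by
  rw [Metric.tendsto_atTop]
  intro ε hε
  have huc := isCompact_Icc.uniformContinuousOn_of_continuous (hg.continuousOn (s := Set.Icc 0 c))
  obtain ⟨δ, hδ, h⟩ := Metric.uniformContinuousOn_iff.1 huc (ε / 2) (by positivity)
  obtain ⟨N₀, hN₀⟩ := exists_nat_gt (c / δ)
  refine ⟨N₀ + 1, fun N hN => ?_⟩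
  have hNpos : (0 : ℝ) < N := by exact_mod_cast (by omega : 0 < N)
  have hcN : c / N < δ := by
    rw [div_lt_iff₀ hNpos]
    rw [div_lt_iff₀ hδ] at hN₀
    have : (N₀ : ℝ) ≤ N := by exact_mod_cast (by omega : N₀ ≤ N)
    nlinarith
  have hint : ∀ a b, IntervalIntegrable g volume a b := fun a b => hg.intervalIntegrable a b
  have hsum := intervalIntegral.sum_integral_adjacent_intervals (f := g) (μ := volume)
    (a := fun k : ℕ => c * k / N) (n := N) (fun k _ => hint _ _)
  have h0 : c * ((0 : ℕ) : ℝ) / N = 0 := by simp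
  have h1 : c * (N : ℝ) / N = c := by field_simp
  simp only [h0, h1] at hsum
  have hdiff : ∀ k : ℕ, c * ((k + 1 : ℕ) : ℝ) / N - c * k / N = c / N := fun k => by
    push_cast; ring
  have hterm : ∀ k ∈ Finset.range N, ‖(c / N) * g (c * k / N) -
      ∫ t in (c * k / N)..(c * ((k + 1 : ℕ) : ℝ) / N), g t‖ ≤ ε / 2 * (c / N) := fun k hk => by
    have hkN : ((k + 1 : ℕ) : ℝ) ≤ N := by exact_mod_cast Finset.mem_range.1 hk
    have hle : c * k / N ≤ c * ((k + 1 : ℕ) : ℝ) / N := by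
      rw [← sub_nonneg, hdiff]; positivity
    have hupper : c * ((k + 1 : ℕ) : ℝ) / N ≤ c := by
      rw [div_le_iff₀ hNpos]; gcongr
    have hlow : 0 ≤ c * k / N := by positivity
    have : (c / N) * g (c * k / N) =
        ∫ t in (c * k / N)..(c * ((k + 1 : ℕ) : ℝ) / N), g (c * k / N) := by
      rw [intervalIntegral.integral_const, hdiff, smul_eq_mul]
    rw [this, ← intervalIntegral.integral_sub (by simp) (hint _ _)]
    refine (intervalIntegral.norm_integral_le_of_norm_le_const fun t ht => ?_).trans_eq
      (by rw [hdiff, abs_of_pos (by positivity)])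
    rw [Set.uIoc_of_le hle] at ht
    refine (h (c * k / N) ⟨hlow, hle.trans hupper⟩ t ⟨hlow.trans ht.1.le, ht.2.trans hupper⟩ ?_).le
    rw [Real.dist_eq, abs_sub_comm, abs_of_pos (by linarith [ht.1])]
    linarith [hdiff k, ht.2]
  have hmain : ‖(c / N) * ∑ k ∈ Finset.range N, g (c * k / N) - ∫ t in (0 : ℝ)..c, g t‖ ≤
      ε / 2 * c := by
    rw [← hsum, Finset.mul_sum, ← Finset.sum_sub_distrib]
    refine (norm_sum_le _ _).trans ((Finset.sum_le_sum hterm).trans_eq ?_)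
    simp; field_simp
  have heq : (N : ℝ)⁻¹ * ∑ k ∈ Finset.range N, g (c * k / N) - c⁻¹ * ∫ t in (0 : ℝ)..c, g t =
      c⁻¹ * ((c / N) * ∑ k ∈ Finset.range N, g (c * k / N) - ∫ t in (0 : ℝ)..c, g t) := by
    field_simp
  rw [dist_eq_norm, heq, norm_mul, Real.norm_of_nonneg (by positivity)]
  calc c⁻¹ * _ ≤ c⁻¹ * (ε / 2 * c) := by gcongr
    _ = ε / 2 := by field_simp
    _ < ε := by linarith

/-! ### The law and the log-potential of the symbol -/

theorem measurable_symbol (a : ℂ[T;T⁻¹]) : Measurable (symbol a) := by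
  have : symbol a = fun w => ∑ m ∈ a.coeff.support, a.coeff m * w ^ m := rfl
  rw [this]
  fun_prop

theorem symbol_circleMap (a : ℂ[T;T⁻¹]) (θ : ℝ) :
    symbol a (circleMap 0 1 θ) =
      ∑ m ∈ a.coeff.support, a.coeff m * Complex.exp (m * (θ * Complex.I)) := by
  rw [symbol_eq_sum]
  refine Finset.sum_congr rfl fun m _ => ?_
  rw [circleMap_zero, Complex.ofReal_one, one_mul, Complex.exp_int_mul]

theorem continuous_symbol_circleMap (a : ℂ[T;T⁻¹]) :
    Continuous fun θ : ℝ => symbol a (circleMap 0 1 θ) := by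
  simp_rw [symbol_circleMap]
  fun_prop

/-- The curve traced by the symbol on the unit circle. -/
def symbolCurve (a : ℂ[T;T⁻¹]) : Set ℂ := Set.range fun θ : ℝ => symbol a (circleMap 0 1 θ)

/-- The image of a smooth curve in the plane is a null set, by Sard's lemma for the map
`z ↦ 𝒂(exp (i re z))`, whose differential is singular everywhere. -/
theorem volume_symbolCurve (a : ℂ[T;T⁻¹]) : volume (symbolCurve a) = 0 := by
  set f : ℂ → ℂ := fun z => symbol a (circleMap 0 1 z.re) with hf
  have hd : ∀ z, DifferentiableAt ℝ f z := fun z => by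
    simp only [hf, symbol_circleMap]
    fun_prop
  have himg : symbolCurve a = f '' Set.univ := by
    rw [Set.image_univ]
    ext w
    constructor
    · rintro ⟨θ, rfl⟩; exact ⟨θ, by simp [hf]⟩
    · rintro ⟨z, rfl⟩; exact ⟨z.re, rfl⟩
  rw [himg]
  refine addHaar_image_eq_zero_of_det_fderivWithin_eq_zero volume
    (fun z _ => (hd z).hasFDerivAt.hasFDerivWithinAt) fun z _ => ?_
  -- the derivative in the direction `i` vanishes
  have hI : fderiv ℝ f z Complex.I = 0 := by
    have h1 : HasDerivAt (fun t : ℝ => f (z + t • Complex.I)) (fderiv ℝ f z Complex.I) 0 := by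
      have h2 : HasDerivAt (fun t : ℝ => z + t • Complex.I) Complex.I 0 := by
        simpa using ((hasDerivAt_id (0 : ℝ)).smul_const Complex.I).const_add z
      have h3 : HasFDerivAt f (fderiv ℝ f z) (z + (0 : ℝ) • Complex.I) := by
        simpa using (hd z).hasFDerivAt
      exact h3.comp_hasDerivAt (0 : ℝ) h2
    have h4 : (fun t : ℝ => f (z + t • Complex.I)) = fun _ => f z := by
      funext t; simp [hf]
    rw [h4] at h1
    exact h1.unique (hasDerivAt_const _ _)
  by_contra hdet
  have hinj : Function.Injective (fderiv ℝ f z : ℂ →ₗ[ℝ] ℂ) := by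
    rw [← LinearMap.ker_eq_bot]
    exact (LinearMap.equivOfDetNeZero _ hdet).ker
  exact Complex.I_ne_zero (hinj (by simpa using hI))

theorem exists_pos_le_norm_sub_symbol {a : ℂ[T;T⁻¹]} {z : ℂ} (hz : z ∉ symbolCurve a) :
    ∃ η : ℝ, 0 < η ∧ ∀ w : ℂ, ‖w‖ = 1 → η ≤ ‖z - symbol a w‖ := by
  have hc : Continuous fun θ : ℝ => ‖z - symbol a (circleMap 0 1 θ)‖ :=
    (continuous_const.sub (continuous_symbol_circleMap a)).norm
  obtain ⟨θ₀, -, h⟩ := (isCompact_Icc (a := -Real.pi) (b := Real.pi)).exists_isMinOn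
    ⟨0, by simp [Real.pi_pos.le]⟩ hc.continuousOn
  refine ⟨_, norm_pos_iff.2 (sub_ne_zero.2 fun h' => hz ⟨θ₀, h'.symm⟩), fun w hw => ?_⟩
  have : w = circleMap 0 1 w.arg := by
    rw [circleMap_zero, Complex.ofReal_one, one_mul]
    conv_lhs => rw [← Complex.norm_mul_exp_arg_mul_I w, hw]
    simp
  rw [this]
  exact h ⟨(Complex.neg_pi_lt_arg w).le, Complex.arg_le_pi w⟩

instance : IsProbabilityMeasure uniformCircle := by
  have hm : Measurable (circleMap 0 1) := (continuous_circleMap 0 1).measurable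
  constructor
  rw [uniformCircle, Measure.map_apply hm MeasurableSet.univ]
  simp only [Set.preimage_univ, Measure.smul_apply, Measure.restrict_apply_univ, Real.volume_Ioc,
    sub_zero, smul_eq_mul]
  exact ENNReal.inv_mul_cancel (by simp [Real.pi_pos]) ENNReal.ofReal_ne_top

instance (a : ℂ[T;T⁻¹]) : IsProbabilityMeasure (symbolLaw a) :=
  Measure.isProbabilityMeasure_map (measurable_symbol a).aemeasurable

theorem ae_uniformCircle {p : ℂ → Prop} (hp : MeasurableSet {w | p w})
    (h : ∀ w, ‖w‖ = 1 → p w) : ∀ᵐ w ∂uniformCircle, p w := by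
  have hm : Measurable (circleMap 0 1) := (continuous_circleMap 0 1).measurable
  rw [uniformCircle, ae_map_iff hm.aemeasurable hp]
  exact Eventually.of_forall fun θ => h _ (by simp [circleMap_zero])

theorem ae_norm_le_symbolLaw (a : ℂ[T;T⁻¹]) : ∀ᵐ x ∂symbolLaw a, ‖x‖ ≤ coeffNorm a := by
  have hs : MeasurableSet {x : ℂ | ‖x‖ ≤ coeffNorm a} := measurableSet_le (by fun_prop) (by fun_prop)
  rw [symbolLaw, ae_map_iff (measurable_symbol a).aemeasurable hs]
  exact ae_uniformCircle (measurable_symbol a hs) fun w hw => norm_symbol_le a hw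

theorem measurable_log_norm_sub (z : ℂ) : Measurable fun x : ℂ => Real.log ‖z - x‖ :=
  Real.measurable_log.comp (by fun_prop)

theorem integrable_log_norm_sub_symbolLaw {a : ℂ[T;T⁻¹]} {z : ℂ} (hz : z ∉ symbolCurve a) :
    Integrable (fun x => Real.log ‖z - x‖) (symbolLaw a) := by
  obtain ⟨η, hη, h⟩ := exists_pos_le_norm_sub_symbol hz
  refine Integrable.of_bound (measurable_log_norm_sub z).aestronglyMeasurable
    (max |Real.log η| |Real.log (‖z‖ + coeffNorm a)|) ?_
  have hs : MeasurableSet {x : ℂ | ‖Real.log ‖z - x‖‖ ≤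
      max |Real.log η| |Real.log (‖z‖ + coeffNorm a)|} :=
    measurableSet_le (measurable_log_norm_sub z).norm measurable_const
  rw [symbolLaw, ae_map_iff (measurable_symbol a).aemeasurable hs]
  refine ae_uniformCircle (measurable_symbol a hs) fun w hw => ?_
  have h1 := h w hw
  rw [Real.norm_eq_abs]
  refine abs_le_max_abs_abs (Real.log_le_log hη h1) (Real.log_le_log (hη.trans_le h1) ?_)
  exact (norm_sub_le _ _).trans (by gcongr; exact norm_symbol_le a hw)

theorem logPotential_symbolLaw (a : ℂ[T;T⁻¹]) (z : ℂ) :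
    logPotential (symbolLaw a) z =
      (2 * Real.pi)⁻¹ * ∫ θ in (0 : ℝ)..2 * Real.pi,
        Real.log ‖z - symbol a (circleMap 0 1 θ)‖ := by
  have hm : Measurable (circleMap 0 1) := (continuous_circleMap 0 1).measurable
  have hpi : 0 ≤ 2 * Real.pi := by positivity
  have hlog : Measurable fun w => Real.log ‖z - symbol a w‖ :=
    (measurable_log_norm_sub z).comp (measurable_symbol a)
  rw [logPotential, symbolLaw, integral_map (measurable_symbol a).aemeasurable
    (measurable_log_norm_sub z).aestronglyMeasurable, uniformCircle,
    integral_map hm.aemeasurable hlog.aestronglyMeasurable,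
    integral_smul_measure, ENNReal.toReal_inv, ENNReal.toReal_ofReal hpi,
    intervalIntegral.integral_of_le hpi, smul_eq_mul]

theorem rootOfUnity_pow_eq_circleMap (N k : ℕ) :
    rootOfUnity N ^ k = circleMap 0 1 (2 * Real.pi * k / N) := by
  rw [rootOfUnity, circleMap_zero, ← Complex.exp_nat_mul]
  push_cast
  rw [one_mul]
  congr 1
  ring

theorem tendsto_sum_log_norm_sub_symbol {a : ℂ[T;T⁻¹]} {z : ℂ} (hz : z ∉ symbolCurve a) :
    Tendsto (fun N : ℕ => (N : ℝ)⁻¹ * ∑ k : Fin N,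
      Real.log ‖z - symbol a (rootOfUnity N ^ (k : ℕ))‖) atTop
      (𝓝 (logPotential (symbolLaw a) z)) := by
  have hc : Continuous fun θ : ℝ => Real.log ‖z - symbol a (circleMap 0 1 θ)‖ := by
    refine Continuous.log (continuous_const.sub (continuous_symbol_circleMap a)).norm fun θ => ?_
    exact norm_ne_zero_iff.2 (sub_ne_zero.2 fun h => hz ⟨θ, h.symm⟩)
  rw [logPotential_symbolLaw]
  refine (tendsto_riemann_sum hc (by positivity)).congr fun N => ?_
  rw [← Fin.sum_univ_eq_sum_range
    (fun k => Real.log ‖z - symbol a (circleMap 0 1 (2 * Real.pi * k / N))‖)]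
  simp_rw [rootOfUnity_pow_eq_circleMap]

/-! ### The random perturbation and its determinant -/

/-- The probability space: one point of the unit interval for each size and each position. -/
abbrev NoiseSpace : Type := ℕ × ℕ × ℕ → unitInterval

/-- The product of uniform distributions. -/
noncomputable def noiseMeasure : Measure NoiseSpace := Measure.infinitePi fun _ => volume

instance : IsProbabilityMeasure noiseMeasure := by unfold noiseMeasure; infer_instance

/-- The noise variables, all independent and uniformly distributed in the unit interval. -/
def noise (N : ℕ) (i j : Fin N) (ω : NoiseSpace) : ℝ := ω (N, i, j)

theorem noise_mem_Icc (N : ℕ) (i j : Fin N) (ω : NoiseSpace) : noise N i j ω ∈ Set.Icc (0 : ℝ) 1 :=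
  (ω (N, i, j)).2

theorem measurable_noise (N : ℕ) (i j : Fin N) : Measurable (noise N i j) := by
  unfold noise; fun_prop

theorem map_noise (N : ℕ) (i j : Fin N) :
    noiseMeasure.map (noise N i j) = volume.restrict (Set.Icc (0 : ℝ) 1) := by
  have h : noise N i j = Subtype.val ∘ fun ω : NoiseSpace => ω (N, i, j) := rfl
  rw [h, ← Measure.map_map measurable_subtype_coe (measurable_pi_apply _), noiseMeasure,
    Measure.infinitePi_map_eval, unitInterval.measurePreserving_coe.map_eq]

theorem isBoundedDensityArray_noise : IsBoundedDensityArray noiseMeasure noise where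
  measurable := measurable_noise
  indep N := by
    have h : iIndepFun (fun (p : ℕ × ℕ × ℕ) (ω : NoiseSpace) => (ω p : ℝ)) noiseMeasure :=
      iIndepFun_infinitePi (X := fun _ (t : unitInterval) => (t : ℝ)) fun _ => measurable_subtype_coe
    refine h.precomp (g := fun p : Fin N × Fin N => (N, (p.1 : ℕ), (p.2 : ℕ))) fun p q hpq => ?_
    simp only [Prod.mk.injEq, true_and] at hpq
    exact Prod.ext (Fin.ext hpq.1) (Fin.ext hpq.2)
  bounded := ⟨1, fun N i j => Eventually.of_forall fun ω => by
    obtain ⟨h0, h1⟩ := noise_mem_Icc N i j ω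
    rwa [abs_of_nonneg h0]⟩
  hasPDF N i j := by
    refine (hasPDF_iff_of_aemeasurable (measurable_noise N i j).aemeasurable).2 ⟨?_, ?_⟩
    · rw [map_noise]; infer_instance
    · rw [map_noise]; exact Measure.absolutelyContinuous_of_le Measure.restrict_le_self
  pdf_bounded := ⟨1, fun N i j => by
    rw [pdf_def, map_noise]
    filter_upwards [Measure.rnDeriv_restrict_self volume (measurableSet_Icc (a := (0 : ℝ)) (b := 1))]
      with x hx
    rw [hx]
    simp only [Set.indicator_apply, Pi.one_apply, ENNReal.coe_one]
    split_ifs <;> simp⟩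

/-- The random perturbation: uniform noise in the corners, scaled by `N ^ (-(d₁ + d₂ + 2))`. -/
noncomputable def perturbation (d₁ d₂ N : ℕ) (ω : NoiseSpace) : Matrix (Fin N) (Fin N) ℂ :=
  cornerMatrix d₁ d₂ (d₁ + d₂ + 2) fun i j => noise N i j ω

/-- The size `N ^ (-(d₁ + d₂ + 2))` of the perturbation. -/
noncomputable def noiseScale (d₁ d₂ N : ℕ) : ℝ := (N : ℝ) ^ (-(d₁ + d₂ + 2 : ℝ))

theorem noiseScale_pos {d₁ d₂ N : ℕ} (hN : N ≠ 0) : 0 < noiseScale d₁ d₂ N :=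
  Real.rpow_pos_of_pos (by exact_mod_cast Nat.pos_of_ne_zero hN) _

theorem noiseScale_le (d₁ d₂ : ℕ) {N : ℕ} (hN : N ≠ 0) : noiseScale d₁ d₂ N ≤ (N : ℝ)⁻¹ ^ 2 := by
  have h1 : (1 : ℝ) ≤ N := by exact_mod_cast Nat.one_le_iff_ne_zero.2 hN
  calc noiseScale d₁ d₂ N ≤ (N : ℝ) ^ (-2 : ℝ) :=
        Real.rpow_le_rpow_of_exponent_le h1 (by
          have : (0 : ℝ) ≤ d₁ + d₂ := by positivity
          linarith)
    _ = _ := by rw [Real.rpow_neg (by positivity), inv_pow]; norm_cast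

theorem noiseScale_le_one (d₁ d₂ : ℕ) {N : ℕ} (hN : N ≠ 0) : noiseScale d₁ d₂ N ≤ 1 := by
  have h1 : (1 : ℝ) ≤ N := by exact_mod_cast Nat.one_le_iff_ne_zero.2 hN
  exact (noiseScale_le d₁ d₂ hN).trans (pow_le_one₀ (by positivity) (inv_le_one_of_one_le₀ h1))

/-- The index, in the noise space, of the `k`-th position in the corners. -/
noncomputable def cornerPosition (d₁ d₂ N : ℕ) (k : Fin (Fintype.card (CornerIndex d₁ d₂ N))) :
    ℕ × ℕ × ℕ :=
  (N, (cornerEquiv d₁ d₂ N k).1.1, (cornerEquiv d₁ d₂ N k).1.2)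

theorem cornerPosition_injective (d₁ d₂ N : ℕ) : Function.Injective (cornerPosition d₁ d₂ N) :=
  fun k l h => by
    simp only [cornerPosition, Prod.mk.injEq, true_and] at h
    exact (cornerEquiv d₁ d₂ N).injective
      (Subtype.ext (Prod.ext (Fin.ext h.1) (Fin.ext h.2)))

/-- The noise in the corners. -/
noncomputable def cornerNoise (d₁ d₂ N : ℕ) (ω : NoiseSpace) :
    Fin (Fintype.card (CornerIndex d₁ d₂ N)) → unitInterval := fun k => ω (cornerPosition d₁ d₂ N k)

theorem cornerNoise_surjective (d₁ d₂ N : ℕ) : Function.Surjective (cornerNoise d₁ d₂ N) :=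
  fun t => ⟨Function.extend (cornerPosition d₁ d₂ N) t fun _ => 0,
    funext fun k => (cornerPosition_injective d₁ d₂ N).extend_apply t _ k⟩

theorem measurePreserving_cornerNoise (d₁ d₂ N : ℕ) :
    MeasurePreserving (cornerNoise d₁ d₂ N) noiseMeasure volume := by
  refine ⟨by unfold cornerNoise; fun_prop, ?_⟩
  have := Measure.map_infinitePi_infinitePi_of_inj
    (P := fun _ : ℕ × ℕ × ℕ => (volume : Measure unitInterval)) (cornerPosition_injective d₁ d₂ N)
  rw [Measure.infinitePi_eq_pi (ι := Fin _)] at this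
  exact this

theorem perturbation_eq (d₁ d₂ N : ℕ) (ω : NoiseSpace) :
    perturbation d₁ d₂ N ω =
      (noiseScale d₁ d₂ N : ℂ) • cornerFill d₁ d₂ N (cubePoint (cornerNoise d₁ d₂ N ω)) := by
  ext i j
  simp only [perturbation, cornerMatrix, noiseScale, cornerFill, Matrix.of_apply, Matrix.smul_apply,
    smul_eq_mul]
  by_cases h : InCorner d₁ d₂ N i j
  · simp only [h, if_true, dif_pos, cubePoint, cornerNoise, cornerPosition,
      Equiv.apply_symm_apply, noise]
    push_cast; rfl
  · simp [h]

theorem det_sub_perturbation (a : ℂ[T;T⁻¹]) (d₁ d₂ N : ℕ) (z : ℂ) (ω : NoiseSpace) :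
    (z • 1 - (toeplitz a N + perturbation d₁ d₂ N ω)).det =
      cornerDet (z • 1 - toeplitz a N) (noiseScale d₁ d₂ N : ℂ)
        (cubePoint (cornerNoise d₁ d₂ N ω)) := by
  rw [perturbation_eq, cornerDet, sub_add_eq_sub_sub]

theorem norm_perturbation_apply_le {d₁ d₂ N : ℕ} (hN : N ≠ 0) (ω : NoiseSpace) (i j : Fin N) :
    ‖perturbation d₁ d₂ N ω i j‖ ≤ noiseScale d₁ d₂ N := by
  have h0 : 0 < noiseScale d₁ d₂ N := noiseScale_pos hN
  simp only [perturbation, cornerMatrix, Matrix.of_apply]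
  split_ifs
  · obtain ⟨h1, h2⟩ := noise_mem_Icc N i j ω
    rw [Complex.norm_real]
    change ‖noiseScale d₁ d₂ N * noise N i j ω‖ ≤ _
    rw [Real.norm_of_nonneg (mul_nonneg h0.le h1)]
    exact mul_le_of_le_one_right h0.le h2
  · simpa using h0.le

theorem perturbation_apply_eq_zero {d₁ d₂ N : ℕ} (ω : NoiseSpace) {i j : Fin N}
    (h : ¬ InCorner d₁ d₂ N i j) : perturbation d₁ d₂ N ω i j = 0 := by
  simp [perturbation, cornerMatrix, h]

/-- The bound for the mean deviation of the logarithm of the determinant. The first term bounds the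
determinant from above, with `r` the number of perturbed columns, `η` a lower bound for the distance of
`z` to the curve and `S` the sum of the moduli of the coefficients; the second is the loss in the
anti-concentration of the at most `r ^ 2` noise variables at scale `N ^ (-γ)`. -/
noncomputable def logDetError (r N : ℕ) (η S γ : ℝ) : ℝ :=
  2 * Real.log (r.factorial * (1 + N * (η⁻¹ * (S + 1))) ^ r) +
    (r ^ 2 : ℕ) * (Real.log (1 + (N : ℝ) ^ γ * S + 2) + 2)

/-- The mean deviation of the logarithm of the determinant of `z - T_N - Δ_N` from that of `z - C`,
with `C` the circulant matrix with the same symbol. The determinant is multi-affine in the noise,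
and equals that of `z - C` at a point of polynomial size, the one that completes `T_N` to `C`; the
upper bound holds because `T_N + Δ_N - C` has few non-zero columns. -/
theorem lintegral_log_det_sub_le {a : ℂ[T;T⁻¹]} {d₁ d₂ : ℕ}
    (ha : ∀ k : ℤ, a.coeff k ≠ 0 → -(d₂ : ℤ) ≤ k ∧ k ≤ (d₁ : ℤ)) {N : ℕ} (hN : N ≠ 0)
    (h₁ : d₁ ≤ N) (h₂ : d₂ ≤ N) {z : ℂ} {η : ℝ} (hη : 0 < η)
    (hz : ∀ w : ℂ, ‖w‖ = 1 → η ≤ ‖z - symbol a w‖) :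
    ∫⁻ ω, ‖Real.log ‖(z • 1 - (toeplitz a N + perturbation d₁ d₂ N ω)).det‖ -
        ∑ k : Fin N, Real.log ‖z - symbol a (rootOfUnity N ^ (k : ℕ))‖‖ₑ ∂noiseMeasure ≤
      ENNReal.ofReal (logDetError (d₁ + d₂) N η (coeffNorm a) (d₁ + d₂ + 2)) := by
  set n := Fintype.card (CornerIndex d₁ d₂ N)
  set s := noiseScale d₁ d₂ N with hs
  have hs0 : 0 < s := noiseScale_pos hN
  have hsinv : s⁻¹ = (N : ℝ) ^ (d₁ + d₂ + 2 : ℝ) := by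
    rw [hs, noiseScale, ← Real.rpow_neg (by positivity), neg_neg]
  have hS := coeffNorm_nonneg a
  set ev : Fin N → ℂ := fun k => z - symbol a (rootOfUnity N ^ (k : ℕ)) with hev
  have hroot : ∀ k : Fin N, ‖rootOfUnity N ^ (k : ℕ)‖ = 1 := fun k => by
    rw [norm_pow, norm_rootOfUnity hN, one_pow]
  have hevη : ∀ k, η ≤ ‖ev k‖ := fun k => hz _ (hroot k)
  have hev0 : ∀ k, ev k ≠ 0 := fun k => norm_pos_iff.1 (hη.trans_le (hevη k))
  have hcirc : spectralCirculant ev = z • 1 - symbolCirculant a N :=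
    spectralCirculant_const_sub z _
  set M := z • 1 - toeplitz a N with hM
  set f : (Fin n → ℂ) → ℂ := cornerDet M (s : ℂ) with hf
  -- the entries that complete the Toeplitz matrix to the circulant matrix
  set y : Fin n → ℂ := fun k => (s : ℂ)⁻¹ *
    (symbolCirculant a N - toeplitz a N) (cornerEquiv d₁ d₂ N k).1.1 (cornerEquiv d₁ d₂ N k).1.2
    with hy
  have hfill : (s : ℂ) • cornerFill d₁ d₂ N y = symbolCirculant a N - toeplitz a N := by
    ext i j
    by_cases h : InCorner d₁ d₂ N i j
    · simp only [cornerFill, Matrix.smul_apply, Matrix.of_apply, h, dif_pos, hy,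
        Equiv.apply_symm_apply, smul_eq_mul]
      rw [mul_inv_cancel_left₀ (by exact_mod_cast hs0.ne')]
    · rw [symbolCirculant_sub_toeplitz_apply_eq_zero ha h₁ h₂ h]
      simp [cornerFill, h]
  have hfy : f y = ∏ k, ev k := by
    rw [hf, cornerDet, hfill, hM, sub_sub_sub_cancel_right, ← hcirc, det_spectralCirculant]
  have hfy0 : f y ≠ 0 := by rw [hfy]; exact Finset.prod_ne_zero_iff.2 fun k _ => hev0 k
  have hlogy : Real.log ‖f y‖ = ∑ k, Real.log ‖ev k‖ := by
    rw [hfy, norm_prod, Real.log_prod fun k _ => norm_ne_zero_iff.2 (hev0 k)]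
  set Y := 1 + s⁻¹ * coeffNorm a
  have hY : 1 ≤ Y := by
    have : 0 ≤ s⁻¹ * coeffNorm a := by positivity
    linarith
  have hyY : ∀ k, ‖y k‖ ≤ Y := fun k => by
    rw [hy, norm_mul, norm_inv, Complex.norm_real, Real.norm_of_nonneg hs0.le]
    have : s⁻¹ * ‖(symbolCirculant a N - toeplitz a N) (cornerEquiv d₁ d₂ N k).1.1
        (cornerEquiv d₁ d₂ N k).1.2‖ ≤ s⁻¹ * coeffNorm a := by
      gcongr; exact norm_symbolCirculant_sub_toeplitz_apply_le a _ _
    linarith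
  set D : ℝ := (d₁ + d₂).factorial * (1 + N * (η⁻¹ * (coeffNorm a + 1))) ^ (d₁ + d₂) with hD
  have hD1 : 1 ≤ D := by
    refine one_le_mul_of_one_le_of_one_le ?_ (one_le_pow₀ ?_)
    · exact_mod_cast Nat.one_le_iff_ne_zero.2 (Nat.factorial_ne_zero _)
    · have : 0 ≤ N * (η⁻¹ * (coeffNorm a + 1)) := by positivity
      linarith
  have hup : ∀ ω, ‖f (cubePoint (cornerNoise d₁ d₂ N ω))‖ ≤ D * ‖f y‖ := fun ω => by
    have hinv : spectralCirculant ev * spectralCirculant ev⁻¹ = 1 := by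
      rw [spectralCirculant_mul, ← spectralCirculant_one]
      congr 1; ext k; simp [hev0 k]
    have h3 := norm_det_add_le (r := d₁ + d₂) (e := coeffNorm a + 1)
      (E := (symbolCirculant a N - toeplitz a N) - perturbation d₁ d₂ N ω) hinv
      (norm_spectralCirculant_apply_le hN (κ := η⁻¹) fun k => by
        rw [Pi.inv_apply, norm_inv]; exact inv_anti₀ hη (hevη k))
      (fun i j => by
        rw [Matrix.sub_apply]
        exact (norm_sub_le _ _).trans (add_le_add
          (norm_symbolCirculant_sub_toeplitz_apply_le a i j)
          ((norm_perturbation_apply_le hN ω i j).trans (noiseScale_le_one d₁ d₂ hN))))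
      (by positivity) (by positivity) (cornerColumns d₁ d₂ N) (card_cornerColumns_le _ _ _)
      (fun i j hj => by
        have h : ¬ InCorner d₁ d₂ N i j := fun h => hj h.col_mem
        rw [Matrix.sub_apply, symbolCirculant_sub_toeplitz_apply_eq_zero ha h₁ h₂ h,
          perturbation_apply_eq_zero ω h, sub_zero])
    have h4 : spectralCirculant ev + ((symbolCirculant a N - toeplitz a N) -
        perturbation d₁ d₂ N ω) = z • 1 - (toeplitz a N + perturbation d₁ d₂ N ω) := by
      rw [hcirc]; abel
    rw [h4, det_sub_perturbation, det_spectralCirculant, ← hfy] at h3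
    exact h3
  have hA : 0 ≤ Real.log D := Real.log_nonneg hD1
  have hmain := (isMultiAffine_cornerDet M (s : ℂ)).lintegral_abs_log_sub_le
    (continuous_cornerDet M (s : ℂ)) hY hA hyY hfy0 fun t => by
      obtain ⟨ω, rfl⟩ := cornerNoise_surjective d₁ d₂ N t
      rw [Real.exp_log (by linarith)]
      exact hup ω
  have hmeas : Measurable fun t : Fin n → unitInterval =>
      ‖Real.log ‖f (cubePoint t)‖ - Real.log ‖f y‖‖ₑ :=
    ((Real.measurable_log.comp ((continuous_cornerDet M (s : ℂ)).comp
      continuous_cubePoint).measurable.norm).sub measurable_const).enorm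
  calc _ = ∫⁻ ω, ‖Real.log ‖f (cubePoint (cornerNoise d₁ d₂ N ω))‖ - Real.log ‖f y‖‖ₑ
        ∂noiseMeasure := by
        simp_rw [det_sub_perturbation, hlogy]; rfl
    _ = ∫⁻ t : Fin n → unitInterval, ‖Real.log ‖f (cubePoint t)‖ - Real.log ‖f y‖‖ₑ :=
        (measurePreserving_cornerNoise d₁ d₂ N).lintegral_comp hmeas
    _ ≤ _ := hmain
    _ ≤ _ := by
        apply ENNReal.ofReal_le_ofReal
        rw [logDetError, ← hsinv]
        have hlog : 0 ≤ Real.log (Y + 2) := Real.log_nonneg (by linarith)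
        have hcard : (n : ℝ) ≤ ((d₁ + d₂) ^ 2 : ℕ) := by
          exact_mod_cast card_cornerIndex_le d₁ d₂ N
        gcongr

/-- The error is logarithmic in `N`. -/
theorem tendsto_logDetError_div (r : ℕ) {η S γ : ℝ} (hη : 0 < η) (hS : 0 ≤ S) (hγ : 0 ≤ γ) :
    Tendsto (fun N : ℕ => (N : ℝ)⁻¹ * logDetError r N η S γ) atTop (𝓝 0) := by
  have hlog : Tendsto (fun N : ℕ => (N : ℝ)⁻¹ * Real.log N) atTop (𝓝 0) := by
    have h := (Real.isLittleO_log_id_atTop.tendsto_div_nhds_zero).comp tendsto_natCast_atTop_atTop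
    refine h.congr fun N => ?_
    simp [div_eq_inv_mul]
  have hinv : Tendsto (fun N : ℕ => (N : ℝ)⁻¹) atTop (𝓝 0) := tendsto_inv_atTop_nhds_zero_nat
  set b := 1 + η⁻¹ * (S + 1) with hb
  have hb1 : 1 ≤ b := by
    have : 0 ≤ η⁻¹ * (S + 1) := by positivity
    linarith
  -- the error is at most an affine function of `log N`
  have hbound : ∀ N : ℕ, 1 ≤ N → logDetError r N η S γ ≤
      (2 * (Real.log r.factorial + r * Real.log b) + (r ^ 2 : ℕ) * (Real.log (S + 3) + 2)) +
        (2 * r + (r ^ 2 : ℕ) * γ) * Real.log N := fun N hN => by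
    have hN1 : (1 : ℝ) ≤ N := by exact_mod_cast hN
    have hN0 : (0 : ℝ) < N := by linarith
    have hf : (0 : ℝ) < r.factorial := by exact_mod_cast r.factorial_pos
    have h1 : 1 + N * (η⁻¹ * (S + 1)) ≤ N * b := by rw [hb]; nlinarith
    have h1' : 0 < 1 + N * (η⁻¹ * (S + 1)) := by positivity
    have h2 : Real.log (1 + N * (η⁻¹ * (S + 1))) ≤ Real.log N + Real.log b := by
      rw [← Real.log_mul hN0.ne' (by linarith)]
      exact Real.log_le_log h1' h1
    have h3 : 1 ≤ (N : ℝ) ^ γ := Real.one_le_rpow hN1 hγ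
    have h4 : Real.log (1 + (N : ℝ) ^ γ * S + 2) ≤ γ * Real.log N + Real.log (S + 3) := by
      rw [← Real.log_rpow hN0, ← Real.log_mul (by positivity) (by positivity)]
      refine Real.log_le_log (by positivity) ?_
      nlinarith
    rw [logDetError, Real.log_mul hf.ne' (by positivity), Real.log_pow]
    have h5 : (r : ℝ) * Real.log (1 + N * (η⁻¹ * (S + 1))) ≤ r * (Real.log N + Real.log b) := by
      gcongr
    have h6 : ((r ^ 2 : ℕ) : ℝ) * (Real.log (1 + (N : ℝ) ^ γ * S + 2) + 2) ≤
      (r ^ 2 : ℕ) * (γ * Real.log N + Real.log (S + 3) + 2) := by gcongr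
    linarith
  have hnonneg : ∀ N : ℕ, 1 ≤ N → 0 ≤ logDetError r N η S γ := fun N hN => by
    have hf : (1 : ℝ) ≤ r.factorial := by
      exact_mod_cast Nat.one_le_iff_ne_zero.2 (Nat.factorial_ne_zero _)
    have h1 : 0 ≤ N * (η⁻¹ * (S + 1)) := by positivity
    have h3 : 0 ≤ (N : ℝ) ^ γ * S := by positivity
    refine add_nonneg (mul_nonneg zero_le_two (Real.log_nonneg ?_))
      (mul_nonneg (Nat.cast_nonneg _) (add_nonneg (Real.log_nonneg (by linarith)) zero_le_two))
    exact one_le_mul_of_one_le_of_one_le hf (one_le_pow₀ (by linarith))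
  set c₁ := (2 * (Real.log r.factorial + r * Real.log b) + (r ^ 2 : ℕ) * (Real.log (S + 3) + 2))
  set c₂ := (2 * r + (r ^ 2 : ℕ) * γ)
  have hlim : Tendsto (fun N : ℕ => (N : ℝ)⁻¹ * c₁ + c₂ * ((N : ℝ)⁻¹ * Real.log N)) atTop (𝓝 0) := by
    simpa using (hinv.mul_const c₁).add (hlog.const_mul c₂)
  refine tendsto_of_tendsto_of_tendsto_of_le_of_le' tendsto_const_nhds hlim ?_ ?_
  · filter_upwards [eventually_ge_atTop 1] with N hN
    exact mul_nonneg (by positivity) (hnonneg N hN)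
  · filter_upwards [eventually_ge_atTop 1] with N hN
    calc _ ≤ (N : ℝ)⁻¹ * (c₁ + c₂ * Real.log N) := by gcongr; exact hbound N hN
      _ = _ := by ring

/-- The normalized logarithm of the modulus of the characteristic polynomial at `z`. -/
noncomputable def logDet {N : ℕ} (A : Matrix (Fin N) (Fin N) ℂ) (z : ℂ) : ℝ :=
  (N : ℝ)⁻¹ * Real.log ‖(z • 1 - A).det‖

/-- Away from the curve traced by the symbol, the log-potentials converge in mean. -/
theorem tendsto_lintegral_logDet_sub {a : ℂ[T;T⁻¹]} {d₁ d₂ : ℕ}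
    (ha : ∀ k : ℤ, a.coeff k ≠ 0 → -(d₂ : ℤ) ≤ k ∧ k ≤ (d₁ : ℤ)) {z : ℂ} (hz : z ∉ symbolCurve a) :
    Tendsto (fun N : ℕ => ∫⁻ ω, ‖logDet (toeplitz a N + perturbation d₁ d₂ N ω) z -
        logPotential (symbolLaw a) z‖ₑ ∂noiseMeasure) atTop (𝓝 0) := by
  obtain ⟨η, hη, h⟩ := exists_pos_le_norm_sub_symbol hz
  set R : ℕ → ℝ := fun N => (N : ℝ)⁻¹ * ∑ k : Fin N,
    Real.log ‖z - symbol a (rootOfUnity N ^ (k : ℕ))‖ with hR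
  have h1 := (ENNReal.tendsto_ofReal (tendsto_logDetError_div (d₁ + d₂) hη (coeffNorm_nonneg a)
    (γ := d₁ + d₂ + 2) (by positivity)))
  have h2 : Tendsto (fun N => ‖R N - logPotential (symbolLaw a) z‖ₑ) atTop (𝓝 0) := by
    have := (tendsto_sum_log_norm_sub_symbol hz).sub_const (logPotential (symbolLaw a) z)
    simpa using this.enorm
  have h3 := h1.add h2
  simp only [ENNReal.ofReal_zero, add_zero] at h3
  refine tendsto_of_tendsto_of_tendsto_of_le_of_le' tendsto_const_nhds h3
    (Eventually.of_forall fun _ => zero_le) ?_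
  filter_upwards [eventually_ge_atTop (d₁ + d₂ + 1)] with N hN
  have hN0 : N ≠ 0 := by omega
  have hle := lintegral_log_det_sub_le ha hN0 (by omega) (by omega) hη h
  calc _ ≤ ∫⁻ ω, (‖(N : ℝ)⁻¹‖ₑ * ‖Real.log ‖(z • 1 - (toeplitz a N +
          perturbation d₁ d₂ N ω)).det‖ -
          ∑ k : Fin N, Real.log ‖z - symbol a (rootOfUnity N ^ (k : ℕ))‖‖ₑ +
          ‖R N - logPotential (symbolLaw a) z‖ₑ) ∂noiseMeasure := by
        refine lintegral_mono fun ω => ?_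
        rw [← enorm_mul]
        refine le_trans (le_of_eq ?_) (enorm_add_le _ _)
        congr 1
        rw [logDet, hR]; ring
    _ = ‖(N : ℝ)⁻¹‖ₑ * (∫⁻ ω, ‖Real.log ‖(z • 1 - (toeplitz a N +
          perturbation d₁ d₂ N ω)).det‖ -
          ∑ k : Fin N, Real.log ‖z - symbol a (rootOfUnity N ^ (k : ℕ))‖‖ₑ ∂noiseMeasure) +
          ‖R N - logPotential (symbolLaw a) z‖ₑ := by
        rw [lintegral_add_right _ measurable_const, lintegral_const_mul' _ _ enorm_ne_top]
        simp
    _ ≤ _ := by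
        gcongr
        rw [ENNReal.ofReal_mul (by positivity), Real.enorm_of_nonneg (by positivity)]
        gcongr

/-! ### Square integrability of the logarithm -/

/-- The logarithm is locally square integrable in the plane. -/
theorem lintegral_enorm_log_norm_sq_lt_top (R : ℝ) :
    ∫⁻ z in Metric.ball (0 : ℂ) R, ‖Real.log ‖z‖‖ₑ ^ 2 < ∞ := by
  -- in polar coordinates the integrand `r (log r) ^ 2` is bounded
  obtain ⟨C, hC⟩ : ∃ C : ℝ, ∀ r ∈ Set.Icc 0 R, r * Real.log r ^ 2 ≤ C := by
    have hcont : Continuous fun r : ℝ => 4 * (√r * Real.log √r) ^ 2 :=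
      ((Real.continuous_mul_log.comp Real.continuous_sqrt).pow 2).const_mul 4
    obtain ⟨C, hC⟩ := (isCompact_Icc (a := (0 : ℝ)) (b := R)).exists_bound_of_continuousOn
      hcont.continuousOn
    refine ⟨C, fun r hr => (le_of_eq ?_).trans ((le_abs_self _).trans (hC r hr))⟩
    rw [Real.log_sqrt hr.1, mul_pow, Real.sq_sqrt hr.1]; ring
  rw [← lintegral_indicator measurableSet_ball, ← Complex.lintegral_comp_polarCoord_symm]
  calc _ ≤ ∫⁻ p in polarCoord.target,
        (Set.Ioc 0 R ×ˢ Set.Ioo (-Real.pi) Real.pi).indicator (fun _ => ENNReal.ofReal C) p := by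
        refine setLIntegral_mono' polarCoord.open_target.measurableSet fun p hp => ?_
        rw [polarCoord_target] at hp
        have hp0 : 0 < p.1 := hp.1
        have hnorm : ‖(Complex.polarCoord.symm p : ℂ)‖ = p.1 := by
          rw [Complex.norm_polarCoord_symm, abs_of_pos hp0]
        by_cases hR : p.1 < R
        · rw [Set.indicator_of_mem (by simpa [hnorm, abs_of_pos hp0] using hR),
            Set.indicator_of_mem
              (show p ∈ Set.Ioc 0 R ×ˢ Set.Ioo (-Real.pi) Real.pi from ⟨⟨hp0, hR.le⟩, hp.2⟩),
            hnorm, smul_eq_mul, Real.enorm_eq_ofReal_abs,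
            ← ENNReal.ofReal_pow (abs_nonneg _), sq_abs, ← ENNReal.ofReal_mul hp0.le]
          exact ENNReal.ofReal_le_ofReal (hC _ ⟨hp0.le, hR.le⟩)
        · rw [Set.indicator_of_notMem (by simpa [hnorm, abs_of_pos hp0] using hR), smul_zero]
          exact zero_le
    _ ≤ ∫⁻ p, (Set.Ioc 0 R ×ˢ Set.Ioo (-Real.pi) Real.pi).indicator (fun _ => ENNReal.ofReal C) p :=
        setLIntegral_le_lintegral _ _
    _ = ENNReal.ofReal C * (volume.prod volume)
          ((Set.Ioc 0 R : Set ℝ) ×ˢ (Set.Ioo (-Real.pi) Real.pi : Set ℝ)) := by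
        rw [lintegral_indicator_const (measurableSet_Ioc.prod measurableSet_Ioo),
          Measure.volume_eq_prod]
    _ < ∞ := by
        rw [Measure.prod_prod, Real.volume_Ioc, Real.volume_Ioo]
        finiteness

/-- A uniform bound for the square integrals over a disc of `z ↦ log |z - x|`, for `x` in the
disc. -/
noncomputable def logSqBound (R : ℝ) : ℝ≥0∞ :=
  ∫⁻ z in Metric.ball (0 : ℂ) (2 * R), ‖Real.log ‖z‖‖ₑ ^ 2

theorem logSqBound_lt_top (R : ℝ) : logSqBound R < ∞ := lintegral_enorm_log_norm_sq_lt_top _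

theorem lintegral_enorm_log_norm_sub_sq_le {R : ℝ} {x : ℂ} (hx : ‖x‖ ≤ R) :
    ∫⁻ z in Metric.ball (0 : ℂ) R, ‖Real.log ‖z - x‖‖ₑ ^ 2 ≤ logSqBound R := by
  rw [logSqBound, ← lintegral_indicator measurableSet_ball, ← lintegral_indicator measurableSet_ball]
  refine le_trans (lintegral_mono fun z => ?_) (lintegral_sub_right_eq_self _ x).le
  refine Set.indicator_apply_le' (fun hz => ?_) fun _ => zero_le
  rw [Set.indicator_of_mem]
  simp only [Metric.mem_ball, dist_zero_right] at hz ⊢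
  linarith [norm_sub_le z x]

theorem le_one_add_sq (y : ℝ≥0∞) : y ≤ 1 + y ^ 2 := by
  rcases le_total y 1 with h | h
  · exact h.trans le_self_add
  · calc y = y * 1 := (mul_one y).symm
      _ ≤ y * y := by gcongr
      _ ≤ 1 + y ^ 2 := by rw [pow_two]; exact le_add_self

theorem measurable_log_norm_sub_right (x : ℂ) : Measurable fun z : ℂ => Real.log ‖z - x‖ :=
  Real.measurable_log.comp (by fun_prop)

theorem lintegral_enorm_log_norm_sub_le {R : ℝ} {x : ℂ} (hx : ‖x‖ ≤ R) :
    ∫⁻ z in Metric.ball (0 : ℂ) R, ‖Real.log ‖z - x‖‖ₑ ≤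
      volume (Metric.ball (0 : ℂ) R) + logSqBound R := by
  calc _ ≤ ∫⁻ z in Metric.ball (0 : ℂ) R, (1 + ‖Real.log ‖z - x‖‖ₑ ^ 2) :=
        lintegral_mono fun z => le_one_add_sq _
    _ = volume (Metric.ball (0 : ℂ) R) +
          ∫⁻ z in Metric.ball (0 : ℂ) R, ‖Real.log ‖z - x‖‖ₑ ^ 2 := by
        rw [lintegral_add_left measurable_const]; simp
    _ ≤ _ := by gcongr; exact lintegral_enorm_log_norm_sub_sq_le hx

theorem integrableOn_log_norm_sub_ball (R : ℝ) (x : ℂ) :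
    IntegrableOn (fun z : ℂ => Real.log ‖z - x‖) (Metric.ball 0 R) := by
  have h : IntegrableOn (fun z : ℂ => Real.log ‖z - x‖) (Metric.ball 0 (max R ‖x‖)) := by
    refine ⟨(measurable_log_norm_sub_right x).aestronglyMeasurable, ?_⟩
    refine (lintegral_enorm_log_norm_sub_le (le_max_right R ‖x‖)).trans_lt ?_
    exact ENNReal.add_lt_top.2 ⟨measure_ball_lt_top, logSqBound_lt_top _⟩
  exact h.mono_set (Metric.ball_subset_ball (le_max_left _ _))

/-! ### A bump function with an explicit potential -/

theorem log_add_posLog_inv_mul {r t : ℝ} (hr : 0 < r) (ht : 0 ≤ t) :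
    Real.log r + Real.posLog (r⁻¹ * t) = Real.log (max r t) := by
  rw [Real.posLog_eq_log_max_one (by positivity), ← Real.log_mul hr.ne' (by positivity)]
  congr 1
  rw [mul_max_of_nonneg _ _ hr.le, mul_one, mul_inv_cancel_left₀ hr.ne']

theorem circleAverage_log_norm_sub {r : ℝ} (hr : 0 < r) (x : ℂ) :
    Real.circleAverage (fun w => Real.log ‖w - x‖) 0 r = Real.log (max r ‖x‖) := by
  rw [circleAverage_log_norm_sub_const_eq_log_radius_add_posLog hr.ne', zero_sub, norm_neg,
    log_add_posLog_inv_mul hr (norm_nonneg x)]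

/-- The mean value property of `log |z - x|` over circles, integrated over a rotation invariant
set. -/
theorem setIntegral_log_norm_sub {S : Set ℝ} (hS : MeasurableSet S) {R : ℝ}
    (hS' : S ⊆ Set.Ioo 0 R) (x : ℂ) :
    ∫ z in (norm ⁻¹' S : Set ℂ), Real.log ‖z - x‖ =
      ∫ z in (norm ⁻¹' S : Set ℂ), Real.log (max ‖z‖ ‖x‖) := by
  set A : Set ℂ := norm ⁻¹' S with hA
  have hAm : MeasurableSet A := measurable_norm hS
  have hAR : A ⊆ Metric.ball 0 R := fun z hz => by simpa using (hS' hz).2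
  have hint : IntegrableOn (fun z : ℂ => Real.log ‖z - x‖) A :=
    (integrableOn_log_norm_sub_ball R x).mono_set hAR
  have hrot : ∀ (θ : ℝ), MeasurePreserving (fun z : ℂ => circleMap 0 1 θ * z)
      (volume.restrict A) (volume.restrict A) := fun θ => by
    have h1 : MeasurePreserving (fun z : ℂ => circleMap 0 1 θ * z) := by
      have h2 := (rotation (Circle.exp θ)).measurePreserving
      have h3 : (⇑(rotation (Circle.exp θ)) : ℂ → ℂ) = fun z : ℂ => circleMap 0 1 θ * z := by
        funext z; simp [rotation_apply, circleMap_zero]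
      rwa [h3] at h2
    have h4 := h1.restrict_preimage hAm
    have h5 : (fun z : ℂ => circleMap 0 1 θ * z) ⁻¹' A = A := by
      ext z; simp [hA, circleMap_zero]
    rwa [h5] at h4
  have hmeas : Measurable (Function.uncurry fun (θ : ℝ) (z : ℂ) =>
      Real.log ‖circleMap 0 1 θ * z - x‖) := by
    refine Real.measurable_log.comp (Measurable.norm ?_)
    refine Measurable.sub_const (Measurable.mul ?_ measurable_snd) x
    exact (continuous_circleMap 0 1).measurable.comp measurable_fst
  have hθ : ∀ θ : ℝ, Integrable (fun z : ℂ => Real.log ‖circleMap 0 1 θ * z - x‖)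
      (volume.restrict A) := fun θ => (hrot θ).integrable_comp_of_integrable hint
  have hθeq : ∀ θ : ℝ, ∫ z in A, Real.log ‖circleMap 0 1 θ * z - x‖ =
      ∫ z in A, Real.log ‖z - x‖ := fun θ => by
    conv_rhs => rw [← (hrot θ).map_eq]
    rw [integral_map (hrot θ).measurable.aemeasurable
      (measurable_log_norm_sub_right x).aestronglyMeasurable]
  have hθnorm : ∀ θ : ℝ, ∫ z in A, ‖Real.log ‖circleMap 0 1 θ * z - x‖‖ =
      ∫ z in A, ‖Real.log ‖z - x‖‖ := fun θ => by
    conv_rhs => rw [← (hrot θ).map_eq]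
    rw [integral_map (hrot θ).measurable.aemeasurable
      (measurable_log_norm_sub_right x).norm.aestronglyMeasurable]
  have hprod : Integrable (Function.uncurry fun (θ : ℝ) (z : ℂ) =>
      Real.log ‖circleMap 0 1 θ * z - x‖)
      ((volume.restrict (Set.Ioc 0 (2 * Real.pi))).prod (volume.restrict A)) := by
    rw [integrable_prod_iff hmeas.aestronglyMeasurable]
    refine ⟨Eventually.of_forall hθ, ?_⟩
    simp only [Function.uncurry_apply_pair, hθnorm]
    exact integrable_const _
  have hswap := integral_integral_swap hprod
  simp only [hθeq] at hswap
  have hpi : (0 : ℝ) < 2 * Real.pi := by positivity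
  rw [integral_const, measureReal_restrict_apply_univ, Real.volume_real_Ioc_of_le hpi.le, sub_zero,
    smul_eq_mul] at hswap
  have hcirc : ∀ z ∈ A, ∫ θ in Set.Ioc 0 (2 * Real.pi), Real.log ‖circleMap 0 1 θ * z - x‖ =
      2 * Real.pi * Real.log (max ‖z‖ ‖x‖) := fun z hz => by
    rw [← circleAverage_log_norm_sub (hS' hz).1 x, Real.circleAverage_eq_integral_add z.arg,
      intervalIntegral.integral_of_le hpi.le, smul_eq_mul, mul_inv_cancel_left₀ hpi.ne']
    congr 1
    funext θ
    congr 3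
    rw [circleMap_zero, circleMap_zero, Complex.ofReal_add, add_mul, Complex.exp_add]
    conv_lhs => rw [← Complex.norm_mul_exp_arg_mul_I z]
    push_cast; ring
  rw [setIntegral_congr_fun hAm hcirc, integral_const_mul] at hswap
  exact mul_left_cancel₀ hpi.ne' hswap

/-- The open annulus of radii `r` and `s` around the origin. -/
def annulus (r s : ℝ) : Set ℂ := norm ⁻¹' Set.Ioo r s

theorem measurableSet_annulus (r s : ℝ) : MeasurableSet (annulus r s) :=
  measurable_norm measurableSet_Ioo

theorem annulus_subset_ball (r s : ℝ) : annulus r s ⊆ Metric.ball 0 s := fun z hz => by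
  simpa using hz.2

theorem volume_annulus_lt_top (r s : ℝ) : volume (annulus r s) < ∞ :=
  (measure_mono (annulus_subset_ball r s)).trans_lt measure_ball_lt_top

theorem volume_annulus_pos {r s : ℝ} (hr : 0 < r) (hrs : r < s) : 0 < volume (annulus r s) := by
  refine (isOpen_Ioo.preimage continuous_norm).measure_pos volume ⟨(((r + s) / 2 : ℝ) : ℂ), ?_⟩
  simp only [Set.mem_preimage, Complex.norm_real]
  rw [Real.norm_of_nonneg (by linarith)]
  constructor <;> linarith

/-- The logarithmic potential at `x` of the uniform distribution on an annulus. -/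
noncomputable def annulusPotential (r s : ℝ) (x : ℂ) : ℝ := ⨍ z in annulus r s, Real.log ‖z - x‖

/-- By the mean value property, the potential of an annulus lies between those of its boundary
circles. -/
theorem annulusPotential_mem_Icc {r s : ℝ} (hr : 0 < r) (hrs : r < s) (x : ℂ) :
    annulusPotential r s x ∈ Set.Icc (Real.log (max r ‖x‖)) (Real.log (max s ‖x‖)) := by
  have h0 : annulusPotential r s x = ⨍ z in annulus r s, Real.log (max ‖z‖ ‖x‖) := by
    rw [annulusPotential, setAverage_eq, setAverage_eq, annulus,
      setIntegral_log_norm_sub measurableSet_Ioo (Set.Ioo_subset_Ioo_left hr.le) x]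
  have hmem : ∀ z ∈ annulus r s, Real.log (max ‖z‖ ‖x‖) ∈
      Set.Icc (Real.log (max r ‖x‖)) (Real.log (max s ‖x‖)) := fun z hz => by
    have hz0 : 0 < ‖z‖ := hr.trans hz.1
    exact ⟨Real.log_le_log (lt_max_of_lt_left hr) (max_le_max_right _ hz.1.le),
      Real.log_le_log (lt_max_of_lt_left hz0) (max_le_max_right _ hz.2.le)⟩
  rw [h0]
  refine Convex.set_average_mem (convex_Icc _ _) isClosed_Icc (volume_annulus_pos hr hrs).ne'
    (volume_annulus_lt_top r s).ne ?_ ?_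
  · exact (ae_restrict_iff' (measurableSet_annulus r s)).2 (Eventually.of_forall hmem)
  · refine Measure.integrableOn_of_bounded
      (M := max |Real.log (max r ‖x‖)| |Real.log (max s ‖x‖)|) (volume_annulus_lt_top r s).ne ?_ ?_
    · exact (Real.measurable_log.comp (by fun_prop)).aestronglyMeasurable
    · refine (ae_restrict_iff' (measurableSet_annulus r s)).2 (Eventually.of_forall fun z hz => ?_)
      exact abs_le_max_abs_abs (hmem z hz).1 (hmem z hz).2

theorem measurable_annulusPotential (r s : ℝ) : Measurable (annulusPotential r s) := by
  have h : annulusPotential r s = fun x => (volume.real (annulus r s))⁻¹ •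
      ∫ z in annulus r s, Real.log ‖z - x‖ := by
    funext x; rw [annulusPotential, setAverage_eq]
  rw [h]
  simp_rw [smul_eq_mul]
  refine Measurable.const_mul ?_ _
  refine (StronglyMeasurable.integral_prod_right (f := fun x z : ℂ => Real.log ‖z - x‖) ?_).measurable
  exact (Real.measurable_log.comp (by fun_prop)).stronglyMeasurable

/-- A bump function that is a difference of the logarithmic potentials of two annuli. -/
noncomputable def logBump (ε : ℝ) (x : ℂ) : ℝ :=
  annulusPotential (3 * ε) (4 * ε) x - annulusPotential ε (2 * ε) x

theorem measurable_logBump (ε : ℝ) : Measurable (logBump ε) :=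
  (measurable_annulusPotential _ _).sub (measurable_annulusPotential _ _)

theorem logBump_nonneg {ε : ℝ} (hε : 0 < ε) (x : ℂ) : 0 ≤ logBump ε x := by
  have h1 := (annulusPotential_mem_Icc (by linarith : 0 < 3 * ε) (by linarith : 3 * ε < 4 * ε) x).1
  have h2 := (annulusPotential_mem_Icc hε (by linarith : ε < 2 * ε) x).2
  have h3 : Real.log (max (2 * ε) ‖x‖) ≤ Real.log (max (3 * ε) ‖x‖) :=
    Real.log_le_log (lt_max_of_lt_left (by linarith)) (max_le_max_right _ (by linarith))
  rw [logBump]; linarith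

theorem logBump_le {ε : ℝ} (hε : 0 < ε) (x : ℂ) : logBump ε x ≤ Real.log 4 := by
  have h1 := (annulusPotential_mem_Icc (by linarith : 0 < 3 * ε) (by linarith : 3 * ε < 4 * ε) x).2
  have h2 := (annulusPotential_mem_Icc hε (by linarith : ε < 2 * ε) x).1
  have hpos : 0 < max ε ‖x‖ := lt_max_of_lt_left hε
  have h3 : Real.log (max (4 * ε) ‖x‖) ≤ Real.log 4 + Real.log (max ε ‖x‖) := by
    rw [← Real.log_mul (by norm_num) hpos.ne']
    refine Real.log_le_log (lt_max_of_lt_left (by linarith)) (max_le ?_ ?_)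
    · linarith [le_max_left ε ‖x‖]
    · linarith [le_max_right ε ‖x‖]
  rw [logBump]; linarith

theorem logBump_eq_zero {ε : ℝ} (hε : 0 < ε) {x : ℂ} (hx : 4 * ε ≤ ‖x‖) : logBump ε x = 0 := by
  have h1 := annulusPotential_mem_Icc (by linarith : 0 < 3 * ε) (by linarith : 3 * ε < 4 * ε) x
  have h2 := annulusPotential_mem_Icc hε (by linarith : ε < 2 * ε) x
  rw [max_eq_right hx, max_eq_right (by linarith : 3 * ε ≤ ‖x‖)] at h1
  rw [max_eq_right (by linarith : ε ≤ ‖x‖), max_eq_right (by linarith : 2 * ε ≤ ‖x‖)] at h2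
  rw [logBump]; linarith [h1.1, h1.2, h2.1, h2.2]

theorem log_le_logBump {ε : ℝ} (hε : 0 < ε) {x : ℂ} (hx : ‖x‖ ≤ 2 * ε) :
    Real.log (3 / 2) ≤ logBump ε x := by
  have h1 := (annulusPotential_mem_Icc (by linarith : 0 < 3 * ε) (by linarith : 3 * ε < 4 * ε) x).1
  have h2 := (annulusPotential_mem_Icc hε (by linarith : ε < 2 * ε) x).2
  rw [max_eq_left hx] at h2
  rw [max_eq_left (by linarith)] at h1
  have h3 : Real.log (3 * ε) = Real.log (3 / 2) + Real.log (2 * ε) := by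
    rw [← Real.log_mul (by norm_num) (by linarith)]; congr 1; ring
  rw [logBump]; linarith

theorem norm_logBump_le {ε : ℝ} (hε : 0 < ε) (x : ℂ) : ‖logBump ε x‖ ≤ Real.log 4 := by
  rw [Real.norm_of_nonneg (logBump_nonneg hε x)]; exact logBump_le hε x

theorem integrable_logBump {ε : ℝ} (hε : 0 < ε) : Integrable (logBump ε) := by
  have h1 : IntegrableOn (logBump ε) (Metric.ball 0 (4 * ε)) :=
    Measure.integrableOn_of_bounded measure_ball_lt_top.ne
      (measurable_logBump ε).aestronglyMeasurable (Eventually.of_forall (norm_logBump_le hε))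
  refine h1.integrable_of_forall_notMem_eq_zero fun x hx => logBump_eq_zero hε ?_
  simpa using hx

theorem integral_logBump_pos {ε : ℝ} (hε : 0 < ε) : 0 < ∫ x, logBump ε x := by
  have h0 : 0 < Real.log (3 / 2) := Real.log_pos (by norm_num)
  rw [integral_pos_iff_support_of_nonneg (logBump_nonneg hε) (integrable_logBump hε)]
  refine (Metric.measure_ball_pos volume (0 : ℂ) (by linarith : 0 < 2 * ε)).trans_le
    (measure_mono fun x hx => ?_)
  have hx' : ‖x‖ < 2 * ε := by simpa using hx
  exact (h0.trans_le (log_le_logBump hε hx'.le)).ne'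

/-! ### Comparison of measures through their log-potentials -/

theorem measurable_logPotential (μ : Measure ℂ) [SFinite μ] : Measurable (logPotential μ) := by
  refine (StronglyMeasurable.integral_prod_right (f := fun z x : ℂ => Real.log ‖z - x‖) ?_).measurable
  exact (Real.measurable_log.comp (by fun_prop)).stronglyMeasurable

/-- The logarithmic potentials of probability measures on a disc are uniformly bounded in `L²` of
that disc. -/
theorem lintegral_enorm_logPotential_sq_le {μ : Measure ℂ} [IsProbabilityMeasure μ] {R : ℝ}
    (hμ : ∀ᵐ x ∂μ, ‖x‖ ≤ R) :
    ∫⁻ z in Metric.ball (0 : ℂ) R, ‖logPotential μ z‖ₑ ^ 2 ≤ logSqBound R := by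
  have hm : Measurable (Function.uncurry fun z x : ℂ => ‖Real.log ‖z - x‖‖ₑ ^ 2) :=
    ((Real.measurable_log.comp (by fun_prop)).enorm).pow_const 2
  calc ∫⁻ z in Metric.ball (0 : ℂ) R, ‖logPotential μ z‖ₑ ^ 2
      ≤ ∫⁻ z in Metric.ball (0 : ℂ) R, (∫⁻ x, ‖Real.log ‖z - x‖‖ₑ ^ 2 ∂μ) := by
        refine lintegral_mono fun z => ?_
        have h1 := eLpNorm_le_eLpNorm_of_exponent_le (p := 1) (q := 2) (by norm_num)
          (measurable_log_norm_sub z).aestronglyMeasurable (μ := μ)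
        have h2 : ‖logPotential μ z‖ₑ ≤ eLpNorm (fun x => Real.log ‖z - x‖) 2 μ := by
          refine le_trans ?_ h1
          rw [eLpNorm_one_eq_lintegral_enorm]
          exact enorm_integral_le_lintegral_enorm _
        calc ‖logPotential μ z‖ₑ ^ 2 ≤ (eLpNorm (fun x => Real.log ‖z - x‖) 2 μ) ^ 2 := by gcongr
          _ = _ := by
            rw [eLpNorm_eq_lintegral_rpow_enorm_toReal (by norm_num) (by norm_num)]
            rw [← ENNReal.rpow_natCast, ← ENNReal.rpow_mul]
            simp
    _ = ∫⁻ x, (∫⁻ z in Metric.ball (0 : ℂ) R, ‖Real.log ‖z - x‖‖ₑ ^ 2) ∂μ :=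
        lintegral_lintegral_swap hm.aemeasurable
    _ ≤ ∫⁻ _, logSqBound R ∂μ :=
        lintegral_mono_ae (hμ.mono fun x hx => lintegral_enorm_log_norm_sub_sq_le hx)
    _ = _ := by simp

theorem integrable_log_norm_sub_prod {μ : Measure ℂ} [IsProbabilityMeasure μ] {R : ℝ}
    (hμ : ∀ᵐ x ∂μ, ‖x‖ ≤ R) :
    Integrable (fun p : ℂ × ℂ => Real.log ‖p.1 - p.2‖)
      ((volume.restrict (Metric.ball 0 R)).prod μ) := by
  have hm : Measurable (fun p : ℂ × ℂ => Real.log ‖p.1 - p.2‖) :=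
    Real.measurable_log.comp (by fun_prop)
  refine ⟨hm.aestronglyMeasurable, ?_⟩
  rw [HasFiniteIntegral, lintegral_prod_symm _ hm.enorm.aemeasurable]
  calc _ ≤ ∫⁻ _, (volume (Metric.ball (0 : ℂ) R) + logSqBound R) ∂μ :=
        lintegral_mono_ae (hμ.mono fun x hx => lintegral_enorm_log_norm_sub_le hx)
    _ < ∞ := by
        rw [lintegral_const, measure_univ, mul_one]
        exact ENNReal.add_lt_top.2 ⟨measure_ball_lt_top, logSqBound_lt_top R⟩

theorem integrableOn_logPotential {μ : Measure ℂ} [IsProbabilityMeasure μ] {R : ℝ}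
    (hμ : ∀ᵐ x ∂μ, ‖x‖ ≤ R) : IntegrableOn (logPotential μ) (Metric.ball 0 R) :=
  (integrable_log_norm_sub_prod hμ).integral_prod_left

theorem measurePreserving_add_annulus (r s : ℝ) (c : ℂ) :
    MeasurePreserving (fun z : ℂ => z + c) (volume.restrict (annulus r s))
      (volume.restrict ((fun z : ℂ => z - c) ⁻¹' annulus r s)) := by
  have h := (measurePreserving_add_right (volume : Measure ℂ) c).restrict_preimage
    ((measurable_sub_const c) (measurableSet_annulus r s))
  have h2 : (fun z : ℂ => z + c) ⁻¹' ((fun z : ℂ => z - c) ⁻¹' annulus r s) = annulus r s := by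
    ext z; simp
  rwa [h2] at h

theorem preimage_sub_annulus_subset {r s R : ℝ} {c : ℂ} (hc : ‖c‖ + s ≤ R) :
    (fun z : ℂ => z - c) ⁻¹' annulus r s ⊆ Metric.ball 0 R := fun z hz => by
  have h1 : ‖z - c‖ < s := hz.2
  have h2 := norm_sub_norm_le z c
  simp only [Metric.mem_ball, dist_zero_right]
  linarith

theorem integral_annulusPotential_sub {μ : Measure ℂ} [IsProbabilityMeasure μ] {r s R : ℝ}
    (hμ : ∀ᵐ x ∂μ, ‖x‖ ≤ R) {c : ℂ} (hc : ‖c‖ + s ≤ R) :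
    ∫ x, annulusPotential r s (x - c) ∂μ = (volume.real (annulus r s))⁻¹ *
      ∫ z in (fun z : ℂ => z - c) ⁻¹' annulus r s, logPotential μ z := by
  set A := (fun z : ℂ => z - c) ⁻¹' annulus r s with hA
  have hint : Integrable (Function.uncurry fun z x : ℂ => Real.log ‖z - x‖)
      ((volume.restrict A).prod μ) :=
    (integrable_log_norm_sub_prod hμ).mono_measure
      (Measure.prod_mono (Measure.restrict_mono (preimage_sub_annulus_subset hc) le_rfl) le_rfl)
  have h1 : ∀ x, annulusPotential r s (x - c) = (volume.real (annulus r s))⁻¹ *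
      ∫ z in A, Real.log ‖z - x‖ := fun x => by
    rw [annulusPotential, setAverage_eq, smul_eq_mul, ← (measurePreserving_add_annulus r s c).map_eq,
      integral_map (by fun_prop) (measurable_log_norm_sub_right x).aestronglyMeasurable]
    congr 2
    funext z
    congr 2
    ring
  simp_rw [h1]
  rw [integral_const_mul, ← integral_integral_swap hint]
  rfl

theorem integrable_annulusPotential_sub {μ : Measure ℂ} [IsProbabilityMeasure μ] {r s R : ℝ}
    (hr : 0 < r) (hrs : r < s) (hμ : ∀ᵐ x ∂μ, ‖x‖ ≤ R) (c : ℂ) :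
    Integrable (fun x => annulusPotential r s (x - c)) μ := by
  refine Integrable.of_bound
    ((measurable_annulusPotential r s).comp (measurable_sub_const c)).aestronglyMeasurable
    (max |Real.log r| |Real.log (max s (R + ‖c‖))|) (hμ.mono fun x hx => ?_)
  obtain ⟨h1, h2⟩ := annulusPotential_mem_Icc hr hrs (x - c)
  refine abs_le_max_abs_abs (le_trans ?_ h1) (h2.trans ?_)
  · exact Real.log_le_log hr (le_max_left _ _)
  · refine Real.log_le_log (lt_max_of_lt_left (hr.trans hrs)) (max_le_max_left _ ?_)
    linarith [norm_sub_le x c]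

/-- The integrals of a translate of the bump function against two measures are compared through
their logarithmic potentials. -/
theorem abs_integral_logBump_sub_le {μ ν : Measure ℂ} [IsProbabilityMeasure μ]
    [IsProbabilityMeasure ν] {ε R : ℝ} (hε : 0 < ε) (hμ : ∀ᵐ x ∂μ, ‖x‖ ≤ R)
    (hν : ∀ᵐ x ∂ν, ‖x‖ ≤ R) {c : ℂ} (hc : ‖c‖ + 4 * ε ≤ R) :
    |∫ x, logBump ε (x - c) ∂μ - ∫ x, logBump ε (x - c) ∂ν| ≤
      ((volume.real (annulus (3 * ε) (4 * ε)))⁻¹ + (volume.real (annulus ε (2 * ε)))⁻¹) *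
        ∫ z in Metric.ball (0 : ℂ) R, |logPotential μ z - logPotential ν z| := by
  have hsub : IntegrableOn (fun z => logPotential μ z - logPotential ν z) (Metric.ball 0 R) :=
    (integrableOn_logPotential hμ).sub (integrableOn_logPotential hν)
  have key : ∀ r s : ℝ, 0 < r → r < s → ‖c‖ + s ≤ R →
      |∫ x, annulusPotential r s (x - c) ∂μ - ∫ x, annulusPotential r s (x - c) ∂ν| ≤
      (volume.real (annulus r s))⁻¹ *
        ∫ z in Metric.ball (0 : ℂ) R, |logPotential μ z - logPotential ν z| := fun r s hr hrs hc => by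
    have hA := preimage_sub_annulus_subset (r := r) hc
    rw [integral_annulusPotential_sub hμ hc, integral_annulusPotential_sub hν hc, ← mul_sub,
      ← integral_sub ((integrableOn_logPotential hμ).mono_set hA)
        ((integrableOn_logPotential hν).mono_set hA), abs_mul, abs_of_nonneg (by positivity)]
    gcongr
    refine (abs_integral_le_integral_abs).trans ?_
    exact setIntegral_mono_set hsub.abs (Eventually.of_forall fun z => abs_nonneg _)
      hA.eventuallyLE
  have h1 := key (3 * ε) (4 * ε) (by linarith) (by linarith) hc
  have h2 := key ε (2 * ε) hε (by linarith) (by linarith)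
  have hI : ∀ (ρ : Measure ℂ) [IsProbabilityMeasure ρ], (∀ᵐ x ∂ρ, ‖x‖ ≤ R) →
      ∫ x, logBump ε (x - c) ∂ρ = ∫ x, annulusPotential (3 * ε) (4 * ε) (x - c) ∂ρ -
        ∫ x, annulusPotential ε (2 * ε) (x - c) ∂ρ := fun ρ _ hρ =>
    integral_sub (integrable_annulusPotential_sub (by linarith) (by linarith) hρ c)
      (integrable_annulusPotential_sub hε (by linarith) hρ c)
  rw [hI μ hμ, hI ν hν, add_mul]
  rw [abs_le] at h1 h2 ⊢
  constructor <;> linarith [h1.1, h1.2, h2.1, h2.2]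

/-- Smoothing a continuous function with the bump function changes it little, at points where its
oscillation is small. -/
theorem abs_integral_mul_logBump_sub_le {f : ℂ → ℝ} (hf : Continuous f) {ε R τ : ℝ} (hε : 0 < ε)
    {x : ℂ} (hx : ‖x‖ + 4 * ε ≤ R) (hosc : ∀ u : ℂ, ‖u‖ < 4 * ε → |f (x - u) - f x| ≤ τ) :
    |(∫ c in Metric.closedBall (0 : ℂ) R, f c * logBump ε (x - c)) - (∫ u, logBump ε u) * f x| ≤
      τ * ∫ u, logBump ε u := by
  have h1 : ∫ c in Metric.closedBall (0 : ℂ) R, f c * logBump ε (x - c) =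
      ∫ u, f (x - u) * logBump ε u := by
    rw [setIntegral_eq_integral_of_forall_compl_eq_zero fun c hc => ?_]
    · rw [← integral_sub_left_eq_self _ volume x]
      simp
    · rw [logBump_eq_zero hε, mul_zero]
      have hc' : R < ‖c‖ := by simpa using hc
      have := norm_sub_norm_le c x
      rw [norm_sub_rev] at this
      linarith
  have hτ : ∀ u, ‖(f (x - u) - f x) * logBump ε u‖ ≤ τ * logBump ε u := fun u => by
    rw [norm_mul, Real.norm_of_nonneg (logBump_nonneg hε u), Real.norm_eq_abs]
    by_cases hu : ‖u‖ < 4 * ε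
    · exact mul_le_mul_of_nonneg_right (hosc u hu) (logBump_nonneg hε u)
    · simp [logBump_eq_zero hε (not_lt.1 hu)]
  have hbm := integrable_logBump hε
  have hdiff : Integrable fun u => (f (x - u) - f x) * logBump ε u := by
    refine (hbm.const_mul τ).mono' ?_ (Eventually.of_forall hτ)
    have hfm : Measurable fun u => f (x - u) - f x := by
      have := hf.measurable; fun_prop
    exact (hfm.mul (measurable_logBump ε)).aestronglyMeasurable
  have h2 : ∫ u, f (x - u) * logBump ε u =
      (∫ u, (f (x - u) - f x) * logBump ε u) + (∫ u, logBump ε u) * f x := by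
    rw [← integral_mul_const, ← integral_add hdiff (hbm.mul_const _)]
    congr 1; funext u; ring
  rw [h1, h2, add_sub_cancel_right, ← integral_const_mul, ← Real.norm_eq_abs]
  exact norm_integral_le_of_norm_le (hbm.const_mul τ) (Eventually.of_forall hτ)

theorem integral_integral_mul_logBump_swap {μ : Measure ℂ} [IsProbabilityMeasure μ] (f : ℂ →ᵇ ℝ)
    {ε : ℝ} (hε : 0 < ε) (R : ℝ) :
    Integrable (fun x => ∫ c in Metric.closedBall (0 : ℂ) R, f c * logBump ε (x - c)) μ ∧
    IntegrableOn (fun c => f c * ∫ x, logBump ε (x - c) ∂μ) (Metric.closedBall (0 : ℂ) R) ∧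
    ∫ x, (∫ c in Metric.closedBall (0 : ℂ) R, f c * logBump ε (x - c)) ∂μ =
      ∫ c in Metric.closedBall (0 : ℂ) R, f c * ∫ x, logBump ε (x - c) ∂μ := by
  have : IsFiniteMeasure (volume.restrict (Metric.closedBall (0 : ℂ) R)) :=
    ⟨by rw [Measure.restrict_apply_univ]; exact measure_closedBall_lt_top⟩
  have hint : Integrable (Function.uncurry fun x c : ℂ => f c * logBump ε (x - c))
      (μ.prod (volume.restrict (Metric.closedBall (0 : ℂ) R))) := by
    refine Integrable.of_bound (C := ‖f‖ * Real.log 4) ?_ (Eventually.of_forall fun p => ?_)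
    · have hfm := f.continuous.measurable
      have hb := measurable_logBump ε
      refine Measurable.aestronglyMeasurable ?_
      exact (hfm.comp measurable_snd).mul (hb.comp (measurable_fst.sub measurable_snd))
    · simp only [Function.uncurry, norm_mul]
      gcongr
      · exact f.norm_coe_le_norm _
      · exact norm_logBump_le hε _
  refine ⟨hint.integral_prod_left, ?_, ?_⟩
  · have := hint.integral_prod_right
    simp only [Function.uncurry_apply_pair, integral_const_mul] at this
    exact this
  · rw [integral_integral_swap hint]
    simp only [integral_const_mul]

/-- The integral of a bounded continuous function against a probability measure on a disc is
determined, up to a small error, by the logarithmic potential on a larger disc. -/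
theorem exists_enorm_integral_sub_le (f : ℂ →ᵇ ℝ) (R : ℝ) {τ : ℝ} (hτ : 0 < τ) :
    ∃ C : NNReal, ∀ (μ ν : Measure ℂ) [IsProbabilityMeasure μ] [IsProbabilityMeasure ν],
      (∀ᵐ x ∂μ, ‖x‖ ≤ R) → (∀ᵐ x ∂ν, ‖x‖ ≤ R) →
      ‖∫ x, f x ∂μ - ∫ x, f x ∂ν‖ₑ ≤ ENNReal.ofReal τ +
        C * ∫⁻ z in Metric.ball (0 : ℂ) (R + 2), ‖logPotential μ z - logPotential ν z‖ₑ := by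
  have huc := (isCompact_closedBall (0 : ℂ) (R + 1)).uniformContinuousOn_of_continuous
    f.continuous.continuousOn
  obtain ⟨δ, hδ, h⟩ := Metric.uniformContinuousOn_iff.1 huc (τ / 2) (by positivity)
  set ε := min (δ / 4) (1 / 4)
  have hε : 0 < ε := by positivity
  have hε1 : 4 * ε ≤ 1 := by linarith [min_le_right (δ / 4) (1 / 4)]
  have hεδ : 4 * ε ≤ δ := by linarith [min_le_left (δ / 4) (1 / 4)]
  set m := ∫ u, logBump ε u with hm
  have hm0 : 0 < m := integral_logBump_pos hε
  set B := Metric.closedBall (0 : ℂ) (R + 1) with hB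
  set κ := (volume.real (annulus (3 * ε) (4 * ε)))⁻¹ + (volume.real (annulus ε (2 * ε)))⁻¹
  have hκ0 : 0 ≤ κ := by positivity
  set C : ℝ := m⁻¹ * (‖f‖ * κ * volume.real B) with hC
  have hC0 : 0 ≤ C := by positivity
  refine ⟨C.toNNReal, fun μ ν _ _ hμ hν => ?_⟩
  have hμ' : ∀ᵐ x ∂μ, ‖x‖ ≤ R + 2 := hμ.mono fun x hx => by linarith
  have hν' : ∀ᵐ x ∂ν, ‖x‖ ≤ R + 2 := hν.mono fun x hx => by linarith
  set Z := ∫ z in Metric.ball (0 : ℂ) (R + 2), |logPotential μ z - logPotential ν z| with hZ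
  -- replacing `f` by its mollification
  have hmoll : ∀ (ρ : Measure ℂ) [IsProbabilityMeasure ρ], (∀ᵐ x ∂ρ, ‖x‖ ≤ R) →
      |(∫ x, (∫ c in B, f c * logBump ε (x - c)) ∂ρ) - m * ∫ x, f x ∂ρ| ≤ τ / 2 * m := fun ρ _ hρ => by
    have hi1 := (integral_integral_mul_logBump_swap (μ := ρ) f hε (R + 1)).1
    have hi2 : Integrable (fun x => m * f x) ρ := (f.integrable ρ).const_mul m
    rw [← integral_const_mul, ← integral_sub hi1 hi2, ← Real.norm_eq_abs]
    refine (norm_integral_le_of_norm_le_const (C := τ / 2 * m) (hρ.mono fun x hx => ?_)).trans_eq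
      (by simp)
    refine abs_integral_mul_logBump_sub_le f.continuous hε (by linarith) fun u hu => ?_
    refine (h (x - u) ?_ x ?_ ?_).le
    · have := norm_sub_le x u
      rw [hB, mem_closedBall_zero_iff]; linarith
    · rw [hB, mem_closedBall_zero_iff]; linarith
    · rw [dist_eq_norm]; simpa using hu.trans_le hεδ
  have hdiff : |(∫ x, (∫ c in B, f c * logBump ε (x - c)) ∂μ) -
      ∫ x, (∫ c in B, f c * logBump ε (x - c)) ∂ν| ≤ ‖f‖ * κ * volume.real B * Z := by
    obtain ⟨-, h1, h2⟩ := integral_integral_mul_logBump_swap (μ := μ) f hε (R + 1)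
    obtain ⟨-, h3, h4⟩ := integral_integral_mul_logBump_swap (μ := ν) f hε (R + 1)
    rw [h2, h4, ← integral_sub h1 h3, ← Real.norm_eq_abs]
    refine (norm_setIntegral_le_of_norm_le_const (C := ‖f‖ * (κ * Z)) measure_closedBall_lt_top
      fun c hc => ?_).trans_eq (by ring)
    rw [← mul_sub, norm_mul]
    have hc' : ‖c‖ ≤ R + 1 := by simpa using hc
    gcongr
    · exact f.norm_coe_le_norm c
    · exact abs_integral_logBump_sub_le hε hμ' hν' (by linarith)
  have hfinal : |∫ x, f x ∂μ - ∫ x, f x ∂ν| ≤ τ + C * Z := by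
    have h1 := hmoll μ hμ
    have h2 := hmoll ν hν
    have h3 : m * |∫ x, f x ∂μ - ∫ x, f x ∂ν| ≤ τ * m + ‖f‖ * κ * volume.real B * Z := by
      rw [← abs_of_pos hm0, ← abs_mul, abs_of_pos hm0, mul_sub]
      rw [abs_le] at h1 h2 hdiff ⊢
      constructor <;> linarith [h1.1, h1.2, h2.1, h2.2, hdiff.1, hdiff.2]
    have h4 : C * Z = m⁻¹ * (‖f‖ * κ * volume.real B * Z) := by rw [hC]; ring
    rw [h4, ← sub_le_iff_le_add', inv_mul_eq_div, le_div_iff₀ hm0]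
    linarith
  have hZe : ENNReal.ofReal Z =
      ∫⁻ z in Metric.ball (0 : ℂ) (R + 2), ‖logPotential μ z - logPotential ν z‖ₑ := by
    have hi : IntegrableOn (fun z => logPotential μ z - logPotential ν z) (Metric.ball 0 (R + 2)) :=
      (integrableOn_logPotential hμ').sub (integrableOn_logPotential hν')
    rw [hZ, ← ofReal_integral_norm_eq_lintegral_enorm hi]
    rfl
  rw [← hZe, Real.enorm_eq_ofReal_abs,
    show ((C.toNNReal : NNReal) : ℝ≥0∞) = ENNReal.ofReal C from rfl, ← ENNReal.ofReal_mul hC0,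
    ← ENNReal.ofReal_add hτ.le (by positivity)]
  exact ENNReal.ofReal_le_ofReal hfinal

/-! ### Empirical spectral distributions -/

theorem integrable_and_integral_sum_dirac (s : Multiset ℂ) (f : ℂ → ℝ) :
    Integrable f (s.map Measure.dirac).sum ∧
      ∫ x, f x ∂(s.map Measure.dirac).sum = (s.map f).sum := by
  induction s using Multiset.induction_on with
  | empty => simp
  | cons a s ih =>
    have ha : Integrable f (Measure.dirac a) := integrable_dirac (by simp)
    simp only [Multiset.map_cons, Multiset.sum_cons]
    exact ⟨ha.add_measure ih.1, by rw [integral_add_measure ha ih.1, integral_dirac, ih.2]⟩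

theorem ae_sum_dirac (s : Multiset ℂ) {p : ℂ → Prop} (h : ∀ x ∈ s, p x) :
    ∀ᵐ x ∂(s.map Measure.dirac).sum, p x := by
  induction s using Multiset.induction_on with
  | empty => simp
  | cons a s ih =>
    simp only [Multiset.map_cons, Multiset.sum_cons]
    rw [ae_add_measure_iff, ae_dirac_eq]
    exact ⟨h a (Multiset.mem_cons_self a s), ih fun x hx => h x (Multiset.mem_cons_of_mem hx)⟩

theorem sum_dirac_univ (s : Multiset ℂ) :
    (s.map Measure.dirac).sum (Set.univ : Set ℂ) = s.card := by
  induction s using Multiset.induction_on with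
  | empty => simp
  | cons a s ih =>
    simp only [Multiset.map_cons, Multiset.sum_cons, Measure.add_apply, ih, measure_univ,
      Multiset.card_cons]
    push_cast
    rw [add_comm]

theorem card_roots_charpoly {N : ℕ} (A : Matrix (Fin N) (Fin N) ℂ) :
    A.charpoly.roots.card = N := by
  rw [Polynomial.splits_iff_card_roots.1 (IsAlgClosed.splits _), Matrix.charpoly_natDegree_eq_dim,
    Fintype.card_fin]

theorem isProbabilityMeasure_esd {N : ℕ} (hN : N ≠ 0) (A : Matrix (Fin N) (Fin N) ℂ) :
    IsProbabilityMeasure (esd A) := by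
  constructor
  rw [esd, Measure.smul_apply, sum_dirac_univ, card_roots_charpoly, smul_eq_mul]
  exact ENNReal.inv_mul_cancel (by exact_mod_cast hN) (ENNReal.natCast_ne_top N)

theorem ae_esd {N : ℕ} (A : Matrix (Fin N) (Fin N) ℂ) {p : ℂ → Prop}
    (h : ∀ x ∈ spectrum ℂ A, p x) : ∀ᵐ x ∂(esd A), p x := by
  rw [esd]
  refine Measure.ae_smul_measure (ae_sum_dirac _ fun x hx => h x ?_) _
  exact Matrix.mem_spectrum_iff_isRoot_charpoly.2 (Polynomial.isRoot_of_mem_roots hx)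

theorem mem_spectrum_iff_det_eq_zero {N : ℕ} {A : Matrix (Fin N) (Fin N) ℂ} {z : ℂ} :
    z ∈ spectrum ℂ A ↔ (z • 1 - A).det = 0 := by
  rw [Matrix.mem_spectrum_iff_isRoot_charpoly, Polynomial.IsRoot, Matrix.eval_charpoly,
    Matrix.smul_one_eq_diagonal]
  rfl

theorem volume_spectrum {N : ℕ} (A : Matrix (Fin N) (Fin N) ℂ) : volume (spectrum ℂ A) = 0 := by
  have hfin : (spectrum ℂ A).Finite :=
    (Polynomial.finite_setOfPred_isRoot A.charpoly_monic.ne_zero).subset fun x hx =>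
      Matrix.mem_spectrum_iff_isRoot_charpoly.1 hx
  exact hfin.measure_zero volume

theorem logPotential_esd {N : ℕ} {A : Matrix (Fin N) (Fin N) ℂ} {z : ℂ}
    (hz : z ∉ spectrum ℂ A) : logPotential (esd A) z = logDet A z := by
  have hdet : (z • 1 - A).det = (A.charpoly.roots.map fun x => z - x).prod := by
    rw [← (IsAlgClosed.splits A.charpoly).eval_eq_prod_roots_of_monic A.charpoly_monic,
      Matrix.eval_charpoly, Matrix.smul_one_eq_diagonal]
    rfl
  have hnorm : ‖(z • 1 - A).det‖ = (A.charpoly.roots.map fun x => ‖z - x‖).prod := by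
    rw [hdet]
    change (normHom : ℂ →*₀ ℝ) _ = _
    rw [map_multiset_prod, Multiset.map_map]
    rfl
  rw [logPotential, esd, integral_smul_measure, (integrable_and_integral_sum_dirac _ _).2, logDet,
    hnorm, Real.log_multiset_prod, Multiset.map_map]
  · simp
  · intro x hx
    obtain ⟨w, hw, rfl⟩ := Multiset.mem_map.1 hx
    refine norm_ne_zero_iff.2 (sub_ne_zero.2 ?_)
    rintro rfl
    exact hz (Matrix.mem_spectrum_iff_isRoot_charpoly.2 (Polynomial.isRoot_of_mem_roots hw))

theorem sum_norm_toeplitz_le (a : ℂ[T;T⁻¹]) {N : ℕ} (i : Fin N) :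
    ∑ j, ‖toeplitz a N i j‖ ≤ coeffNorm a := by
  have h1 : ∀ j : Fin N, ‖toeplitz a N i j‖ =
      ∑ m ∈ a.coeff.support, if m = (j : ℤ) - (i : ℤ) then ‖a.coeff m‖ else 0 := fun j => by
    rw [Finset.sum_ite_eq', toeplitz, Matrix.of_apply]
    split_ifs with h
    · rfl
    · simpa using h
  simp_rw [h1]
  rw [Finset.sum_comm, coeffNorm]
  refine Finset.sum_le_sum fun m _ => ?_
  rw [Finset.sum_ite, Finset.sum_const_zero, add_zero, Finset.sum_const, nsmul_eq_mul]
  refine mul_le_of_le_one_left (norm_nonneg _) ?_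
  have hcard : (Finset.univ.filter fun j : Fin N => m = (j : ℤ) - (i : ℤ)).card ≤ 1 :=
    Finset.card_le_one.2 fun j hj k hk => by
      simp only [Finset.mem_filter, Finset.mem_univ, true_and] at hj hk
      exact Fin.ext (by omega)
  exact_mod_cast hcard

/-- The eigenvalues are bounded uniformly in `N`, by the row sums (Gershgorin). -/
theorem norm_le_of_mem_spectrum (a : ℂ[T;T⁻¹]) (d₁ d₂ : ℕ) {N : ℕ} (hN : N ≠ 0) (ω : NoiseSpace)
    {x : ℂ} (hx : x ∈ spectrum ℂ (toeplitz a N + perturbation d₁ d₂ N ω)) :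
    ‖x‖ ≤ coeffNorm a + 1 := by
  have hN1 : (1 : ℝ) ≤ N := by exact_mod_cast Nat.one_le_iff_ne_zero.2 hN
  set A := toeplitz a N + perturbation d₁ d₂ N ω with hA
  rw [← Matrix.spectrum_toLin', ← Module.End.hasEigenvalue_iff_mem_spectrum] at hx
  obtain ⟨k, hk⟩ := eigenvalue_mem_ball hx
  rw [mem_closedBall_iff_norm] at hk
  have h1 : ‖x‖ ≤ ∑ j, ‖A k j‖ := by
    rw [← Finset.add_sum_erase _ _ (Finset.mem_univ k)]
    have := norm_sub_norm_le x (A k k)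
    linarith
  refine h1.trans ?_
  calc ∑ j, ‖A k j‖ ≤ ∑ j, (‖toeplitz a N k j‖ + noiseScale d₁ d₂ N) :=
        Finset.sum_le_sum fun j _ => (norm_add_le _ _).trans
          (by gcongr; exact norm_perturbation_apply_le hN ω k j)
    _ = ∑ j, ‖toeplitz a N k j‖ + N * noiseScale d₁ d₂ N := by
        rw [Finset.sum_add_distrib]; simp
    _ ≤ coeffNorm a + N * (N : ℝ)⁻¹ ^ 2 := by
        gcongr
        · exact sum_norm_toeplitz_le a k
        · exact noiseScale_le d₁ d₂ hN
    _ ≤ coeffNorm a + 1 := by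
        have : (N : ℝ) * (N : ℝ)⁻¹ ^ 2 = (N : ℝ)⁻¹ := by field_simp
        rw [this]
        gcongr
        exact inv_le_one_of_one_le₀ hN1

theorem operatorNorm_le {N : ℕ} {A : Matrix (Fin N) (Fin N) ℂ} {ε : ℝ} (hε : 0 ≤ ε)
    (hA : ∀ i j, ‖A i j‖ ≤ ε) : operatorNorm A ≤ N * ε := by
  refine ContinuousLinearMap.opNorm_le_bound _ (by positivity) fun x => ?_
  have hi : ∀ i, ‖(Matrix.toEuclideanCLM (n := Fin N) (𝕜 := ℂ) A x).ofLp i‖ ≤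
      ε * ∑ j, ‖x.ofLp j‖ := fun i => by
    rw [Matrix.ofLp_toEuclideanCLM, Matrix.mulVec, dotProduct, Finset.mul_sum]
    refine (norm_sum_le _ _).trans (Finset.sum_le_sum fun j _ => ?_)
    rw [norm_mul]
    gcongr
    exact hA i j
  have hx := EuclideanSpace.norm_sq_eq x
  have hcs := sq_sum_le_card_mul_sum_sq (s := Finset.univ) (f := fun j => ‖x.ofLp j‖)
  rw [← hx, Finset.card_univ, Fintype.card_fin] at hcs
  refine (sq_le_sq₀ (norm_nonneg _) (by positivity)).1 ?_
  rw [EuclideanSpace.norm_sq_eq]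
  calc _ ≤ ∑ i : Fin N, (ε * ∑ j, ‖x.ofLp j‖) ^ 2 :=
        Finset.sum_le_sum fun i _ => by gcongr; exact hi i
    _ = N * ε ^ 2 * (∑ j, ‖x.ofLp j‖) ^ 2 := by simp; ring
    _ ≤ N * ε ^ 2 * (N * ‖x‖ ^ 2) := by gcongr
    _ = (N * ε * ‖x‖) ^ 2 := by ring

theorem tendsto_measure_operatorNorm (d₁ d₂ : ℕ) :
    Tendsto (fun N : ℕ => noiseMeasure {ω | (N : ℝ) ^ (-(1 / 2) : ℝ) ≤
      operatorNorm (perturbation d₁ d₂ N ω)}) atTop (𝓝 0) := by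
  refine tendsto_const_nhds.congr' ?_
  filter_upwards [eventually_ge_atTop 2] with N hN
  have hN0 : N ≠ 0 := by omega
  have hN1 : (1 : ℝ) < N := by exact_mod_cast hN
  have hempty : {ω | (N : ℝ) ^ (-(1 / 2) : ℝ) ≤ operatorNorm (perturbation d₁ d₂ N ω)} = ∅ := by
    refine Set.eq_empty_of_forall_notMem fun ω hω => ?_
    have h1 := operatorNorm_le (noiseScale_pos hN0).le
      (norm_perturbation_apply_le (d₁ := d₁) (d₂ := d₂) hN0 ω)
    have h2 : N * noiseScale d₁ d₂ N ≤ (N : ℝ) ^ (-1 : ℝ) := by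
      calc N * noiseScale d₁ d₂ N ≤ N * (N : ℝ)⁻¹ ^ 2 := by gcongr; exact noiseScale_le d₁ d₂ hN0
        _ = _ := by rw [Real.rpow_neg_one]; field_simp
    have h3 : (N : ℝ) ^ (-1 : ℝ) < (N : ℝ) ^ (-(1 / 2) : ℝ) :=
      Real.rpow_lt_rpow_of_exponent_lt hN1 (by norm_num)
    exact absurd (hω.trans (h1.trans h2)) (not_le.2 h3)
  rw [hempty, measure_empty]

theorem ae_notMem_spectrum {a : ℂ[T;T⁻¹]} (d₁ d₂ : ℕ) {N : ℕ} {z : ℂ}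
    (hz : z ∉ spectrum ℂ (toeplitz a N)) :
    ∀ᵐ ω ∂noiseMeasure, z ∉ spectrum ℂ (toeplitz a N + perturbation d₁ d₂ N ω) := by
  set s : ℂ := Complex.ofReal (noiseScale d₁ d₂ N)
  have h0 : cornerDet (d₁ := d₁) (d₂ := d₂) (z • 1 - toeplitz a N) s 0 ≠ 0 := by
    have : cornerFill d₁ d₂ N 0 = 0 := by ext i j; simp [cornerFill]
    rw [cornerDet, this, smul_zero, sub_zero]
    rwa [mem_spectrum_iff_det_eq_zero] at hz
  have h1 := (isMultiAffine_cornerDet (d₁ := d₁) (d₂ := d₂) (z • 1 - toeplitz a N) s).ae_ne_zero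
    (continuous_cornerDet _ _) h0
  have h2 := (measurePreserving_cornerNoise d₁ d₂ N).quasiMeasurePreserving.ae h1
  filter_upwards [h2] with ω hω
  rwa [mem_spectrum_iff_det_eq_zero, det_sub_perturbation]

theorem measurable_logDet (a : ℂ[T;T⁻¹]) (d₁ d₂ N : ℕ) :
    Measurable fun p : ℂ × NoiseSpace => logDet (toeplitz a N + perturbation d₁ d₂ N p.2) p.1 := by
  refine (Real.measurable_log.comp (Continuous.measurable ?_)).const_mul _
  refine (Continuous.matrix_det ?_).norm
  refine continuous_matrix fun i j => ?_
  simp only [Matrix.sub_apply, Matrix.smul_apply, Matrix.add_apply, perturbation, cornerMatrix,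
    Matrix.of_apply, noise]
  split_ifs <;> fun_prop

/-! ### Convergence in probability -/

/-- Convergence in probability from a bound, up to an arbitrarily small constant, by multiples of
non-negative random variables whose means tend to zero. -/
theorem tendstoInMeasure_of_lintegral {Ω : Type*} [MeasurableSpace Ω] {P : Measure Ω}
    {X : ℕ → Ω → ℝ} {c : ℝ} {Y : ℕ → Ω → ℝ≥0∞} (hY : ∀ N, Measurable (Y N))
    (hlim : Tendsto (fun N => ∫⁻ ω, Y N ω ∂P) atTop (𝓝 0))
    (h : ∀ τ : ℝ, 0 < τ → ∃ C : NNReal, ∀ᶠ N in atTop, ∀ᵐ ω ∂P,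
      ‖X N ω - c‖ₑ ≤ ENNReal.ofReal τ + C * Y N ω) :
    TendstoInMeasure P X atTop (fun _ => c) := by
  intro ε hε
  obtain ⟨τ, hτ, hτε⟩ : ∃ τ : ℝ, 0 < τ ∧ 2 * ENNReal.ofReal τ ≤ ε := by
    rcases eq_or_ne ε ∞ with rfl | hε'
    · exact ⟨1, one_pos, le_top⟩
    · refine ⟨ε.toReal / 2, half_pos (ENNReal.toReal_pos hε.ne' hε'), ?_⟩
      rw [← ENNReal.ofReal_ofNat, ← ENNReal.ofReal_mul (by norm_num), mul_div_cancel₀ _ (by norm_num),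
        ENNReal.ofReal_toReal hε']
  obtain ⟨C, hC⟩ := h τ hτ
  have hτ0 : ENNReal.ofReal τ ≠ 0 := by simpa using hτ
  have hlim' : Tendsto (fun N => (C : ℝ≥0∞) * (∫⁻ ω, Y N ω ∂P) / ENNReal.ofReal τ) atTop (𝓝 0) := by
    have h1 := ENNReal.Tendsto.const_mul (a := (C : ℝ≥0∞)) hlim (Or.inr ENNReal.coe_ne_top)
    have h2 := ENNReal.Tendsto.div_const h1 (b := ENNReal.ofReal τ) (Or.inr hτ0)
    simpa using h2
  refine tendsto_of_tendsto_of_tendsto_of_le_of_le' tendsto_const_nhds hlim'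
    (Eventually.of_forall fun _ => zero_le) (hC.mono fun N hN => ?_)
  rw [ENNReal.le_div_iff_mul_le (Or.inl hτ0) (Or.inl ENNReal.ofReal_ne_top)]
  calc P {ω | ε ≤ edist (X N ω) c} * ENNReal.ofReal τ
      ≤ P {ω | ENNReal.ofReal τ ≤ C * Y N ω} * ENNReal.ofReal τ := by
        gcongr 1
        refine measure_mono_ae (hN.mono fun ω hω hmem => ?_)
        have h1 : 2 * ENNReal.ofReal τ ≤ ENNReal.ofReal τ + C * Y N ω := by
          refine (hτε.trans hmem).trans ?_
          rw [edist_eq_enorm_sub]; exact hω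
        rw [two_mul] at h1
        exact (ENNReal.add_le_add_iff_left ENNReal.ofReal_ne_top).1 h1
    _ = ENNReal.ofReal τ * P {ω | ENNReal.ofReal τ ≤ C * Y N ω} := mul_comm _ _
    _ ≤ ∫⁻ ω, C * Y N ω ∂P := mul_meas_ge_le_lintegral₀ ((hY N).const_mul _).aemeasurable _
    _ = _ := lintegral_const_mul _ (hY N)

theorem le_min_add_sq_div (e : ℝ≥0∞) {K : ℝ≥0∞} (hK0 : K ≠ 0) (hK : K ≠ ∞) :
    e ≤ min e K + K⁻¹ * e ^ 2 := by
  rcases le_total e K with h | h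
  · rw [min_eq_left h]; exact le_self_add
  · calc e = K⁻¹ * (K * e) := by rw [← mul_assoc, ENNReal.inv_mul_cancel hK0 hK, one_mul]
      _ ≤ K⁻¹ * (e * e) := by gcongr
      _ ≤ _ := by rw [pow_two]; exact le_add_self

/-- A uniform `L²` bound upgrades pointwise convergence in mean, at almost every parameter, to
convergence of the integrals over the parameter. -/
theorem tendsto_lintegral_of_sq_bounded {Ω : Type*} [MeasurableSpace Ω] {P : Measure Ω}
    [IsProbabilityMeasure P] {S : Set ℂ} (hS : volume S < ∞) {g : ℕ → ℂ → Ω → ℝ≥0∞}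
    (hg : ∀ N, Measurable (Function.uncurry (g N))) {C : ℝ≥0∞} (hC : C ≠ ∞)
    (hsq : ∀ᶠ N in atTop, ∀ ω, ∫⁻ z in S, g N z ω ^ 2 ≤ C)
    (hlim : ∀ᵐ z, Tendsto (fun N => ∫⁻ ω, g N z ω ∂P) atTop (𝓝 0)) :
    Tendsto (fun N => ∫⁻ ω, (∫⁻ z in S, g N z ω) ∂P) atTop (𝓝 0) := by
  rw [ENNReal.tendsto_nhds_zero]
  intro ε hε
  obtain ⟨K, hK0, hK, hKC⟩ : ∃ K : ℝ≥0∞, K ≠ 0 ∧ K ≠ ∞ ∧ K⁻¹ * C ≤ ε / 2 := by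
    rcases eq_or_ne ε ∞ with rfl | hε'
    · exact ⟨1, one_ne_zero, ENNReal.one_ne_top, by simp [ENNReal.top_div]⟩
    have hε2 : ε / 2 ≠ 0 := (ENNReal.half_pos hε.ne').ne'
    have hε2' : ε / 2 ≠ ∞ := ENNReal.div_ne_top hε' two_ne_zero
    refine ⟨(C + 1) / (ε / 2), ?_, ENNReal.div_ne_top (by finiteness) hε2, ?_⟩
    · exact (ENNReal.div_pos (by simp) hε2').ne'
    · rw [ENNReal.inv_div (Or.inl hε2') (Or.inl hε2), ENNReal.div_eq_inv_mul, mul_right_comm]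
      refine mul_le_of_le_one_left zero_le ?_
      rw [mul_comm, ← ENNReal.div_eq_inv_mul.trans (mul_comm _ _)]
      exact ENNReal.div_le_of_le_mul (by rw [one_mul]; exact le_self_add)
  -- the truncated integrals converge by dominated convergence
  have hmin : Tendsto (fun N => ∫⁻ z in S, ∫⁻ ω, min (g N z ω) K ∂P) atTop (𝓝 0) := by
    have h := tendsto_lintegral_of_dominated_convergence (μ := volume.restrict S)
      (F := fun N z => ∫⁻ ω, min (g N z ω) K ∂P) (f := fun _ => 0) (fun _ => K)
      (fun N => ((hg N).min measurable_const).lintegral_prod_right')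
      (fun N => Eventually.of_forall fun z => by
        calc _ ≤ ∫⁻ _, K ∂P := lintegral_mono fun ω => min_le_right _ _
          _ = K := by simp)
      (by rw [setLIntegral_const]; exact ENNReal.mul_ne_top hK hS.ne)
      (ae_restrict_of_ae (hlim.mono fun z hz => tendsto_of_tendsto_of_tendsto_of_le_of_le
        tendsto_const_nhds hz (fun _ => zero_le) fun N => lintegral_mono fun ω => min_le_left _ _))
    simpa using h
  have hε2 : 0 < ε / 2 := ENNReal.half_pos hε.ne'
  filter_upwards [ENNReal.tendsto_nhds_zero.1 hmin (ε / 2) hε2, hsq] with N hN hsqN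
  have hmeas1 : Measurable (Function.uncurry fun z ω => min (g N z ω) K) :=
    (hg N).min measurable_const
  have hswap : AEMeasurable (Function.uncurry fun ω z => min (g N z ω) K)
      (P.prod (volume.restrict S)) := (hmeas1.comp measurable_swap).aemeasurable
  calc ∫⁻ ω, (∫⁻ z in S, g N z ω) ∂P
      ≤ ∫⁻ ω, ((∫⁻ z in S, min (g N z ω) K) + ε / 2) ∂P := by
        refine lintegral_mono fun ω => ?_
        have hm : Measurable fun z => min (g N z ω) K := hmeas1.of_uncurry_right
        calc ∫⁻ z in S, g N z ω ≤ ∫⁻ z in S, (min (g N z ω) K + K⁻¹ * g N z ω ^ 2) :=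
              lintegral_mono fun z => le_min_add_sq_div _ hK0 hK
          _ = (∫⁻ z in S, min (g N z ω) K) + K⁻¹ * ∫⁻ z in S, g N z ω ^ 2 := by
              rw [lintegral_add_left hm, lintegral_const_mul' _ _ (ENNReal.inv_ne_top.2 hK0)]
          _ ≤ _ := by
              gcongr
              exact le_trans (by gcongr; exact hsqN ω) hKC
    _ = (∫⁻ ω, (∫⁻ z in S, min (g N z ω) K) ∂P) + ε / 2 := by
        rw [lintegral_add_right _ measurable_const]; simp
    _ = (∫⁻ z in S, ∫⁻ ω, min (g N z ω) K ∂P) + ε / 2 := by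
        rw [lintegral_lintegral_swap hswap]
    _ ≤ ε / 2 + ε / 2 := by gcongr
    _ = ε := ENNReal.add_halves ε

/-- The log-potentials of the empirical spectral distributions converge in mean, in `L¹` of any
large disc. -/
theorem tendsto_lintegral_lintegral_logDet_sub {a : ℂ[T;T⁻¹]} {d₁ d₂ : ℕ}
    (ha : ∀ k : ℤ, a.coeff k ≠ 0 → -(d₂ : ℤ) ≤ k ∧ k ≤ (d₁ : ℤ)) {R : ℝ}
    (hR : coeffNorm a + 1 ≤ R) :
    Tendsto (fun N : ℕ => ∫⁻ ω, (∫⁻ z in Metric.ball (0 : ℂ) R,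
      ‖logDet (toeplitz a N + perturbation d₁ d₂ N ω) z - logPotential (symbolLaw a) z‖ₑ)
      ∂noiseMeasure) atTop (𝓝 0) := by
  have hlaw : ∀ᵐ x ∂symbolLaw a, ‖x‖ ≤ R := (ae_norm_le_symbolLaw a).mono fun x hx => by linarith
  have hmL := measurable_logPotential (symbolLaw a)
  refine tendsto_lintegral_of_sq_bounded (C := 2 * (logSqBound R + logSqBound R))
    measure_ball_lt_top (fun N => ?_) ?_ ?_ ?_
  · exact ((measurable_logDet a d₁ d₂ N).sub (hmL.comp measurable_fst)).enorm
  · have := logSqBound_lt_top R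
    finiteness
  · filter_upwards [eventually_ne_atTop 0] with N hN ω
    have := isProbabilityMeasure_esd hN (toeplitz a N + perturbation d₁ d₂ N ω)
    have hesd : ∀ᵐ x ∂esd (toeplitz a N + perturbation d₁ d₂ N ω), ‖x‖ ≤ R :=
      ae_esd _ fun x hx => (norm_le_of_mem_spectrum a d₁ d₂ hN ω hx).trans hR
    have hae : ∀ᵐ z, z ∉ spectrum ℂ (toeplitz a N + perturbation d₁ d₂ N ω) :=
      measure_eq_zero_iff_ae_notMem.1 (volume_spectrum _)
    calc _ ≤ ∫⁻ z in Metric.ball (0 : ℂ) R, 2 *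
          (‖logPotential (esd (toeplitz a N + perturbation d₁ d₂ N ω)) z‖ₑ ^ 2 +
            ‖logPotential (symbolLaw a) z‖ₑ ^ 2) := by
          refine lintegral_mono_ae (ae_restrict_of_ae (hae.mono fun z hz => ?_))
          rw [← logPotential_esd hz]
          have h2 := ENNReal.rpow_add_le_mul_rpow_add_rpow
            ‖logPotential (esd (toeplitz a N + perturbation d₁ d₂ N ω)) z‖ₑ
            ‖logPotential (symbolLaw a) z‖ₑ (p := 2) (by norm_num)
          norm_num at h2
          exact le_trans (by gcongr; exact enorm_sub_le) h2
      _ = 2 * ((∫⁻ z in Metric.ball (0 : ℂ) R,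
            ‖logPotential (esd (toeplitz a N + perturbation d₁ d₂ N ω)) z‖ₑ ^ 2) +
          ∫⁻ z in Metric.ball (0 : ℂ) R, ‖logPotential (symbolLaw a) z‖ₑ ^ 2) := by
          rw [lintegral_const_mul' _ _ (by norm_num), lintegral_add_right _ (hmL.enorm.pow_const 2)]
      _ ≤ _ := by
          gcongr
          · exact lintegral_enorm_logPotential_sq_le hesd
          · exact lintegral_enorm_logPotential_sq_le hlaw
  · filter_upwards [measure_eq_zero_iff_ae_notMem.1 (volume_symbolCurve a)] with z hz
    exact tendsto_lintegral_logDet_sub ha hz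

/-- The test integrals are controlled by the `L¹` distance of the log-potentials on a disc, whose
mean tends to zero. -/
theorem tendstoWeaklyInProbability_esd {a : ℂ[T;T⁻¹]} {d₁ d₂ : ℕ}
    (ha : ∀ k : ℤ, a.coeff k ≠ 0 → -(d₂ : ℤ) ≤ k ∧ k ≤ (d₁ : ℤ)) :
    TendstoWeaklyInProbability noiseMeasure
      (fun N ω => esd (toeplitz a N + perturbation d₁ d₂ N ω)) (symbolLaw a) := by
  intro f
  set R := coeffNorm a + 1
  refine tendstoInMeasure_of_lintegral (fun N => ?_)
    (tendsto_lintegral_lintegral_logDet_sub ha (R := R + 2) (by linarith)) fun τ hτ => ?_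
  · have hm : Measurable (Function.uncurry fun (ω : NoiseSpace) (z : ℂ) =>
        ‖logDet (toeplitz a N + perturbation d₁ d₂ N ω) z - logPotential (symbolLaw a) z‖ₑ) :=
      (((measurable_logDet a d₁ d₂ N).comp measurable_swap).sub
        ((measurable_logPotential (symbolLaw a)).comp measurable_snd)).enorm
    exact hm.lintegral_prod_right'
  · obtain ⟨C, hC⟩ := exists_enorm_integral_sub_le f R hτ
    refine ⟨C, (eventually_ne_atTop 0).mono fun N hN => Eventually.of_forall fun ω => ?_⟩
    have := isProbabilityMeasure_esd hN (toeplitz a N + perturbation d₁ d₂ N ω)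
    refine (hC (esd (toeplitz a N + perturbation d₁ d₂ N ω)) (symbolLaw a)
      (ae_esd _ fun x hx => norm_le_of_mem_spectrum a d₁ d₂ hN ω hx)
      ((ae_norm_le_symbolLaw a).mono fun x hx => by linarith)).trans_eq ?_
    congr 2
    refine lintegral_congr_ae (ae_restrict_of_ae ?_)
    filter_upwards [measure_eq_zero_iff_ae_notMem.1
      (volume_spectrum (toeplitz a N + perturbation d₁ d₂ N ω))] with z hz
    rw [logPotential_esd hz]

theorem tendstoInMeasure_logPotential_esd {a : ℂ[T;T⁻¹]} {d₁ d₂ : ℕ}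
    (ha : ∀ k : ℤ, a.coeff k ≠ 0 → -(d₂ : ℤ) ≤ k ∧ k ≤ (d₁ : ℤ)) {z : ℂ} (hz : z ∉ symbolCurve a)
    (hz' : ∀ N, z ∉ spectrum ℂ (toeplitz a N)) :
    TendstoInMeasure noiseMeasure
      (fun N ω => logPotential (esd (toeplitz a N + perturbation d₁ d₂ N ω)) z) atTop
      (fun _ => logPotential (symbolLaw a) z) := by
  refine tendstoInMeasure_of_lintegral (fun N => ?_) (tendsto_lintegral_logDet_sub ha hz)
    fun τ hτ => ⟨1, Eventually.of_forall fun N => ?_⟩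
  · exact (((measurable_logDet a d₁ d₂ N).comp measurable_prodMk_left).sub_const _).enorm
  · filter_upwards [ae_notMem_spectrum d₁ d₂ (hz' N)] with ω hω
    rw [logPotential_esd hω, ENNReal.coe_one, one_mul]
    exact le_add_self

end ToeplitzPerturbation

theorem theorem1p6 (a : LaurentPolynomial ℂ) (d₁ d₂ : ℕ)
    (ha : ∀ k : ℤ, a.coeff k ≠ 0 → -(d₂ : ℤ) ≤ k ∧ k ≤ (d₁ : ℤ)) :
    ∃ (Ω : Type) (_ : MeasurableSpace Ω) (P : Measure Ω) (_ : IsProbabilityMeasure P)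
      (Δ : ∀ N : ℕ, Ω → Matrix (Fin N) (Fin N) ℂ),
      -- the structure of the perturbation
      (∃ (γs : ℝ) (δ : ∀ N : ℕ, Fin N → Fin N → Ω → ℝ),
        (d₁ : ℝ) + (d₂ : ℝ) < γs ∧ ToeplitzPerturbation.IsBoundedDensityArray P δ ∧
          ∀ N ω, Δ N ω =
            ToeplitzPerturbation.cornerMatrix d₁ d₂ γs (fun i j => δ N i j ω)) ∧
      -- its spectral norm is polynomially small, with probability `1 - o(1)`
      (∃ γ₀ : ℝ, 0 < γ₀ ∧
        Tendsto (fun N : ℕ =>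
          P {ω | (N : ℝ) ^ (-γ₀) ≤ ToeplitzPerturbation.operatorNorm (Δ N ω)}) atTop (𝓝 0)) ∧
      -- the empirical spectral distributions converge weakly, in probability
      ToeplitzPerturbation.TendstoWeaklyInProbability P
        (fun N ω => ToeplitzPerturbation.esd (ToeplitzPerturbation.toeplitz a N + Δ N ω))
        (ToeplitzPerturbation.symbolLaw a) ∧
      -- for almost every `z` the log-potentials are finite and converge in probability
      ∀ᵐ z : ℂ,
        (∀ N : ℕ, ∀ᵐ ω ∂P, z ∉ spectrum ℂ (ToeplitzPerturbation.toeplitz a N + Δ N ω)) ∧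
        Integrable (fun x => Real.log ‖z - x‖) (ToeplitzPerturbation.symbolLaw a) ∧
        TendstoInMeasure P
          (fun N ω => ToeplitzPerturbation.logPotential
            (ToeplitzPerturbation.esd (ToeplitzPerturbation.toeplitz a N + Δ N ω)) z)
          atTop (fun _ => ToeplitzPerturbation.logPotential (ToeplitzPerturbation.symbolLaw a) z) := by
  refine ⟨ToeplitzPerturbation.NoiseSpace, inferInstance, ToeplitzPerturbation.noiseMeasure,
    inferInstance, ToeplitzPerturbation.perturbation d₁ d₂,
    ⟨d₁ + d₂ + 2, ToeplitzPerturbation.noise, by linarith,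
      ToeplitzPerturbation.isBoundedDensityArray_noise, fun N ω => rfl⟩,
    ⟨1 / 2, by norm_num, ToeplitzPerturbation.tendsto_measure_operatorNorm d₁ d₂⟩,
    ToeplitzPerturbation.tendstoWeaklyInProbability_esd ha, ?_⟩
  have h1 := measure_eq_zero_iff_ae_notMem.1 (ToeplitzPerturbation.volume_symbolCurve a)
  have h2 : ∀ᵐ z : ℂ, ∀ N, z ∉ spectrum ℂ (ToeplitzPerturbation.toeplitz a N) :=
    ae_all_iff.2 fun N => measure_eq_zero_iff_ae_notMem.1 (ToeplitzPerturbation.volume_spectrum _)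
  filter_upwards [h1, h2] with z hz hz'
  exact ⟨fun N => ToeplitzPerturbation.ae_notMem_spectrum d₁ d₂ (hz' N),
    ToeplitzPerturbation.integrable_log_norm_sub_symbolLaw hz,
    ToeplitzPerturbation.tendstoInMeasure_logPotential_esd ha hz hz'⟩
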